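/- Let $n\ge 2$. A simple graph is called a split-complete graph $\widehat{K}_n$ if its $n+1$ vertices can be labelled by the numbers $1,2,\dots,n-1$ and two letters $u,v$ in such a way that the numbered vertices are pairwise adjacent and the neighbourhoods of $u$ and $v$ partition the set of numbered vertices (both are nonempty, they are disjoint, and their union is exactly the set of numbered vertices; in particular $u$ and $v$ are not adjacent). A triangular embedding of a finite connected simple graph is a cellular embedding of it in the closed orientable surface $S_g$ of some genus $g\ge 0$ such that every face has exactly three sides; cellular embeddings are given by rotation systems, that is, by a cyclic permutation of the arcs leaving each vertex, and their faces are the orbits of face tracing. **Theorem.** For every integer $s\ge 1$ there is a split-complete graph $\widehat{K}_{12s+6}$ (with $12s+7$ vertices, of which $12s+5$ are numbered) that has a triangular embedding. -/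

import Mathlib

/-- A rotation system of a simple graph `G`: a permutation `rot` of the darts (oriented edges)
whose orbits are exactly the sets of darts leaving a common vertex. Thus `rot` restricts to one
cyclic permutation of the darts leaving each vertex, the rotation at that vertex.
For a finite connected graph, rotation systems are the combinatorial form of the cellular
embeddings of `G` in oriented closed surfaces. -/
structure RotationSystem {V : Type} (G : SimpleGraph V) where
  /-- `rot d` is the dart that follows `d` in the rotation at the initial vertex of `d`. -/
  rot : Equiv.Perm G.Dart
  sameCycle_iff : ∀ d d' : G.Dart, rot.SameCycle d d' ↔ d.fst = d'.fst

namespace RotationSystem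

/-- The permutation that reverses every dart. -/
def flip {V : Type} (G : SimpleGraph V) : Equiv.Perm G.Dart :=
  Function.Involutive.toPerm SimpleGraph.Dart.symm SimpleGraph.Dart.symm_involutive

/-- Face tracing: after traversing the dart `d` from `a` to `b`, continue with the dart that
follows the reverse of `d` in the rotation at `b`. -/
def faceTrace {V : Type} {G : SimpleGraph V} (R : RotationSystem G) : Equiv.Perm G.Dart :=
  (flip G).trans R.rot

/-- The faces are the orbits of face tracing. Every dart of an orbit is one side of the face. -/
def Face {V : Type} {G : SimpleGraph V} (R : RotationSystem G) : Type :=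
  Quotient (Equiv.Perm.SameCycle.setoid R.faceTrace)

/-- The number of sides of the face: the length of its boundary walk. -/
noncomputable def Face.sides {V : Type} {G : SimpleGraph V} {R : RotationSystem G}
    (F : R.Face) : ℕ :=
  Set.ncard {d : G.Dart | (Quotient.mk (Equiv.Perm.SameCycle.setoid R.faceTrace) d) = F}

/-- The rotation system describes a cellular embedding of `G` in the orientable surface `S_g` of
genus `g`: the graph is connected and Euler's formula `|V| - |E| + |F| = 2 - 2g` holds.
(Meant for finite graphs with at least one edge.) -/
def EmbedsInGenus {V : Type} [Finite V] {G : SimpleGraph V} (R : RotationSystem G)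
    (g : ℕ) : Prop :=
  G.Connected ∧
    (Nat.card V : ℤ) - (Nat.card G.edgeSet : ℤ) + (Nat.card R.Face : ℤ) = 2 - 2 * (g : ℤ)

/-- Every face of the embedding has exactly three sides. -/
def IsTriangular {V : Type} {G : SimpleGraph V} (R : RotationSystem G) : Prop :=
  ∀ F : R.Face, F.sides = 3

end RotationSystem

/-- `G` has a triangular embedding in some orientable closed surface. -/
def HasTriangularEmbedding {V : Type} [Finite V] (G : SimpleGraph V) : Prop :=
  ∃ (g : ℕ) (R : RotationSystem G), R.EmbedsInGenus g ∧ R.IsTriangular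

/-- `G` is a split-complete graph `K̂_n`: its vertices can be labelled by `n - 1` numbers
(here the elements of `Fin (n - 1)`) and two letters `u`, `v` such that the numbered vertices are
pairwise adjacent and the neighbourhoods of `u` and `v` partition the set of numbered vertices
(so `u` and `v` are not adjacent). Such a graph has `n + 1` vertices. -/
def IsSplitComplete {V : Type} (n : ℕ) (G : SimpleGraph V) : Prop :=
  ∃ label : Fin (n - 1) ⊕ Fin 2 ≃ V,
    let numbered : Set V := Set.range fun i : Fin (n - 1) => label (Sum.inl i)
    let u : V := label (Sum.inr 0)
    let v : V := label (Sum.inr 1)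
    (∀ a ∈ numbered, ∀ b ∈ numbered, a ≠ b → G.Adj a b) ∧
      G.neighborSet u ∪ G.neighborSet v = numbered ∧
      Disjoint (G.neighborSet u) (G.neighborSet v) ∧
      (G.neighborSet u).Nonempty ∧ (G.neighborSet v).Nonempty

/-! For `s ≥ 2` one starts from a triangulation of the complete graph on `12 * s + 6` vertices
without the three edges of one triangle: the vertices are `12 * s + 3` numbers, and three letters
`x`, `y`, `z` that are joined to all numbers but not to each other. The group `ZMod (4 * s + 1)`
acts on it by translation, with three orbits (classes) of numbers, and fixes the letters. Hence the
triangulation is given by `12 * s + 8` triangles up to translation, and only the links of one number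
per class and of the three letters matter.

Four edge flips then repair the graph. The first gains `xz` and loses an edge `ab` between numbers;
each of the next two regains the edge just lost at the cost of another one; the fourth regains the
last of these at the cost of `ya`. Now only `yx`, `yz` and `ya` are missing, and the first flip has
left a face with the vertices `a`, `z`, `x`. A new vertex `u` placed in this face has exactly these
three neighbours, so `u` and `y` are the two halves of a split vertex (`exists_split`).

The triangulation is certified by counting (`exists_of_card_le`). If a walk in the link of each
vertex visits all required neighbours, every required directed edge lies in a triangle; if there are
no more triangle sides than required directed edges, it lies in exactly one. Uniqueness is thus
free, and it makes each link a single cycle. The walks are checked once for all `s`: labels are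
formal expressions `a * s + b + c * k`, compared modulo `4 * s + 1`, and a link is a few fixed paths
joined by periodic runs in `k`.

The case `s = 1` is an explicit triangulation with 19 vertices. In all cases `splitComplete_of_adj`
turns the triangulation into a rotation system and finds the genus by Euler's formula. -/

open Relation

/-! ### Oriented triangulations and their graphs -/

/-- A closed oriented triangulated surface with vertices in `V`, given by its oriented triangles:
`tri a b c` says that `a`, `b`, `c` are the vertices of a triangle in cyclic order. Every oriented
edge lies in at most one triangle, and the link of every vertex is a single cycle. -/
structure OrientedTriangulation (V : Type) where
  tri : V → V → V → Prop
  rotate : ∀ {a b c}, tri a b c → tri b c a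
  unique : ∀ {a b c d}, tri a b c → tri a b d → c = d
  symm : ∀ {a b c}, tri a b c → ∃ d, tri b a d
  irrefl : ∀ {a b}, ¬ tri a a b
  link : ∀ {a b c x y}, tri a b x → tri a c y → ReflTransGen (tri a) b c

namespace OrientedTriangulation

variable {V : Type}

/-- The three vertices `a`, `b`, `c` in cyclic order. -/
def Rotation (a b c x y z : V) : Prop :=
  (x = a ∧ y = b ∧ z = c) ∨ (x = b ∧ y = c ∧ z = a) ∨ (x = c ∧ y = a ∧ z = b)

theorem Rotation.rotate {a b c x y z : V} (h : Rotation a b c x y z) : Rotation a b c y z x := by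
  rcases h with ⟨h1, h2, h3⟩ | ⟨h1, h2, h3⟩ | ⟨h1, h2, h3⟩
  · exact Or.inr (Or.inl ⟨h2, h3, h1⟩)
  · exact Or.inr (Or.inr ⟨h2, h3, h1⟩)
  · exact Or.inl ⟨h2, h3, h1⟩

/-- Two vertices are adjacent if they span an edge of a triangle. -/
def Adj (T : OrientedTriangulation V) (a b : V) : Prop := ∃ c, T.tri a b c

/-- The graph of a triangulation. -/
def graph (T : OrientedTriangulation V) : SimpleGraph V where
  Adj := T.Adj
  symm := ⟨fun _ _ ⟨_, h⟩ => T.symm h⟩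
  loopless := ⟨fun _ ⟨_, h⟩ => T.irrefl h⟩

theorem Adj.symm {T : OrientedTriangulation V} {a b : V} (h : T.Adj a b) : T.Adj b a :=
  let ⟨_, h⟩ := h; T.symm h

theorem unique_left (T : OrientedTriangulation V) {a b c d : V} (h : T.tri a b c)
    (h' : T.tri a d c) : b = d :=
  T.unique (T.rotate (T.rotate h)) (T.rotate (T.rotate h'))

theorem ne_of_tri (T : OrientedTriangulation V) {a b c : V} (h : T.tri a b c) :
    a ≠ b ∧ b ≠ c ∧ c ≠ a := by
  refine ⟨?_, ?_, ?_⟩ <;> rintro rfl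
  · exact T.irrefl h
  · exact T.irrefl (T.rotate h)
  · exact T.irrefl (T.rotate (T.rotate h))

/-! ### Edge flips -/

/-- The triangles after the flip of the edge `r t` to `p q`. -/
def FlipTri (T : OrientedTriangulation V) (r t p q x y z : V) : Prop :=
  (T.tri x y z ∧ ¬ Rotation r t p x y z ∧ ¬ Rotation t r q x y z) ∨
    Rotation r q p x y z ∨ Rotation q t p x y z

/-- The non-adjacency of `p` and `q` is essential: otherwise the new edge would lie in an old and a
new triangle on the same side. -/
theorem flipTri_unique (T : OrientedTriangulation V) {r t p q : V} (h1 : T.tri r t p)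
    (h2 : T.tri t r q) (hpq : p ≠ q) (hn : ¬ T.Adj p q) {a b c d : V}
    (h : FlipTri T r t p q a b c) (h' : FlipTri T r t p q a b d) : c = d := by
  have hn1 : ∀ z, ¬ T.tri p q z := fun z hz => hn ⟨z, hz⟩
  have hn2 : ∀ z, ¬ T.tri q p z := fun z hz => hn (Adj.symm ⟨z, hz⟩)
  have a1 := T.ne_of_tri h1
  have a2 := T.ne_of_tri h2
  have u : ∀ {a b c d}, T.tri a b c → T.tri a b d → c = d := T.unique
  have e1 := T.rotate h1
  have e2 := T.rotate e1
  have f1 := T.rotate h2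
  have f2 := T.rotate f1
  unfold FlipTri Rotation at h h'
  rcases h with h | (h | h | h) | (h | h | h) <;>
    rcases h' with h' | (h' | h' | h') | (h' | h' | h')
  all_goals grind

-- The link of `r` passes `q, t, p` and loses `t`; the link of `t` passes `p, r, q` and loses `r`.
-- Identifying the lost vertex with its predecessor carries each old step to a walk in the new link.
-- In the links of `p` and `q` one step merely gains an intermediate vertex.
open Classical in
theorem flipTri_link_step (T : OrientedTriangulation V) {r t p q : V} (h1 : T.tri r t p)
    (h2 : T.tri t r q) (hpq : p ≠ q) {a b c : V} (h : T.tri a b c) :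
    ReflTransGen (FlipTri T r t p q a)
      (if a = r ∧ b = t then q else if a = t ∧ b = r then p else b)
      (if a = r ∧ c = t then q else if a = t ∧ c = r then p else c) := by
  have a1 := T.ne_of_tri h1
  have a2 := T.ne_of_tri h2
  have a3 := T.ne_of_tri h
  have u : ∀ {a b c d}, T.tri a b c → T.tri a b d → c = d := T.unique
  have v : ∀ {a b c d}, T.tri a b c → T.tri a d c → b = d := T.unique_left
  have e1 := T.rotate h1
  have e2 := T.rotate e1
  have f1 := T.rotate h2
  have f2 := T.rotate f1
  by_cases k1 : Rotation r t p a b c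
  · rcases k1 with ⟨rfl, rfl, rfl⟩ | ⟨rfl, rfl, rfl⟩ | ⟨rfl, rfl, rfl⟩
    · rw [if_pos ⟨rfl, rfl⟩, if_neg (by grind), if_neg (by grind)]
      exact .single (Or.inr (Or.inl (Or.inl ⟨rfl, rfl, rfl⟩)))
    · rw [if_neg (by grind), if_neg (by grind), if_neg (by grind), if_pos (by grind)]
    · rw [if_neg (by grind), if_neg (by grind), if_neg (by grind), if_neg (by grind)]
      exact .tail (.single (Or.inr (Or.inl (Or.inr (Or.inr ⟨rfl, rfl, rfl⟩)))))
        (Or.inr (Or.inr (Or.inr (Or.inr ⟨rfl, rfl, rfl⟩))))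
  by_cases k2 : Rotation t r q a b c
  · rcases k2 with ⟨rfl, rfl, rfl⟩ | ⟨rfl, rfl, rfl⟩ | ⟨rfl, rfl, rfl⟩
    · rw [if_neg (by grind), if_pos ⟨rfl, rfl⟩, if_neg (by grind), if_neg (by grind)]
      exact .single (Or.inr (Or.inr (Or.inr (Or.inl ⟨rfl, rfl, rfl⟩))))
    · rw [if_neg (by grind), if_neg (by grind), if_pos (by grind)]
    · rw [if_neg (by grind), if_neg (by grind), if_neg (by grind), if_neg (by grind)]
      exact .tail (.single (Or.inr (Or.inr (Or.inl ⟨rfl, rfl, rfl⟩))))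
        (Or.inr (Or.inl (Or.inr (Or.inl ⟨rfl, rfl, rfl⟩))))
  have hs : FlipTri T r t p q a b c := Or.inl ⟨h, k1, k2⟩
  unfold Rotation at k1 k2
  rw [if_neg (by grind), if_neg (by grind), if_neg (by grind), if_neg (by grind)]
  exact .single hs

theorem flipTri_old (T : OrientedTriangulation V) {r t p q : V} (h1 : T.tri r t p)
    (h2 : T.tri t r q) {a b c : V} (h : FlipTri T r t p q a b c) :
    (¬ (a = r ∧ b = t) ∧ ¬ (a = t ∧ b = r) ∧ T.Adj a b) ∨ (a = p ∧ b = q) ∨ (a = q ∧ b = p) := by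
  have a1 := T.ne_of_tri h1
  have a2 := T.ne_of_tri h2
  have u : ∀ {a b c d}, T.tri a b c → T.tri a b d → c = d := T.unique
  have e1 := T.rotate h1
  have e2 := T.rotate e1
  have f1 := T.rotate h2
  have f2 := T.rotate f1
  have A : ∀ {x y z}, T.tri x y z → T.Adj x y := fun h => ⟨_, h⟩
  have g1 := (A e1).symm
  have g2 := (A f1).symm
  have g3 := (A e2).symm
  have g4 := (A f2).symm
  unfold FlipTri Rotation at h
  rcases h with h | (h | h | h) | (h | h | h)
  · have := A h.1
    grind
  all_goals grind

theorem flipTri_exists (T : OrientedTriangulation V) {r t p q : V} (h1 : T.tri r t p)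
    (h2 : T.tri t r q) {a b : V}
    (h : (¬ (a = r ∧ b = t) ∧ ¬ (a = t ∧ b = r) ∧ T.Adj a b) ∨ (a = p ∧ b = q) ∨ (a = q ∧ b = p)) :
    ∃ c, FlipTri T r t p q a b c := by
  rcases h with ⟨k1, k2, c, h⟩ | ⟨rfl, rfl⟩ | ⟨rfl, rfl⟩
  · by_cases l1 : Rotation r t p a b c
    · rcases l1 with ⟨rfl, rfl, rfl⟩ | ⟨rfl, rfl, rfl⟩ | ⟨rfl, rfl, rfl⟩
      · simp at k1
      · exact ⟨q, Or.inr (Or.inr (Or.inr (Or.inl ⟨rfl, rfl, rfl⟩)))⟩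
      · exact ⟨q, Or.inr (Or.inl (Or.inr (Or.inr ⟨rfl, rfl, rfl⟩)))⟩
    by_cases l2 : Rotation t r q a b c
    · rcases l2 with ⟨rfl, rfl, rfl⟩ | ⟨rfl, rfl, rfl⟩ | ⟨rfl, rfl, rfl⟩
      · simp at k2
      · exact ⟨p, Or.inr (Or.inl (Or.inl ⟨rfl, rfl, rfl⟩))⟩
      · exact ⟨p, Or.inr (Or.inr (Or.inl ⟨rfl, rfl, rfl⟩))⟩
    exact ⟨c, Or.inl ⟨h, l1, l2⟩⟩
  · exact ⟨t, Or.inr (Or.inr (Or.inr (Or.inr ⟨rfl, rfl, rfl⟩)))⟩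
  · exact ⟨r, Or.inr (Or.inl (Or.inr (Or.inl ⟨rfl, rfl, rfl⟩)))⟩

/-- The flip of the edge `r t` between the triangles `r t p` and `t r q` to the edge `p q`. -/
def flip (T : OrientedTriangulation V) {r t p q : V} (h1 : T.tri r t p) (h2 : T.tri t r q)
    (hpq : p ≠ q) (hn : ¬ T.Adj p q) : OrientedTriangulation V where
  tri := FlipTri T r t p q
  rotate := by
    intro a b c h
    rcases h with ⟨h, k1, k2⟩ | h | h
    · exact Or.inl ⟨T.rotate h, fun k => k1 k.rotate.rotate, fun k => k2 k.rotate.rotate⟩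
    · exact Or.inr (Or.inl h.rotate)
    · exact Or.inr (Or.inr h.rotate)
  unique := T.flipTri_unique h1 h2 hpq hn
  symm := by
    intro a b c h
    refine T.flipTri_exists h1 h2 ?_
    rcases T.flipTri_old h1 h2 h with ⟨k1, k2, k3⟩ | h | h
    · exact Or.inl ⟨fun h => k2 h.symm, fun h => k1 h.symm, k3.symm⟩
    · exact Or.inr (Or.inr h.symm)
    · exact Or.inr (Or.inl h.symm)
  irrefl := by
    intro a b h
    rcases T.flipTri_old h1 h2 h with ⟨_, _, _, h⟩ | ⟨h, h'⟩ | ⟨h, h'⟩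
    · exact T.irrefl h
    · exact hpq (h.symm.trans h')
    · exact hpq (h'.symm.trans h)
  link := by
    classical
    intro a b c x y hb hc
    have a1 := T.ne_of_tri h1
    have a2 := T.ne_of_tri h2
    have key : ∀ {b c}, T.Adj a b → T.Adj a c → ReflTransGen (FlipTri T r t p q a)
        (if a = r ∧ b = t then q else if a = t ∧ b = r then p else b)
        (if a = r ∧ c = t then q else if a = t ∧ c = r then p else c) := fun ⟨_, hb⟩ ⟨_, hc⟩ =>
      ReflTransGen.lift' (f := fun b => if a = r ∧ b = t then q else if a = t ∧ b = r then p else b)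
        (fun _ _ h => T.flipTri_link_step h1 h2 hpq h) _ _ (T.link hb hc)
    have key' : ∀ {b c}, T.Adj a b → T.Adj a c → ¬ (a = r ∧ b = t) → ¬ (a = t ∧ b = r) →
        ¬ (a = r ∧ c = t) → ¬ (a = t ∧ c = r) → ReflTransGen (FlipTri T r t p q a) b c := by
      intro b c hb hc k1 k2 k3 k4
      have := key hb hc
      rwa [if_neg k1, if_neg k2, if_neg k3, if_neg k4] at this
    have pr : T.Adj p r := ⟨_, T.rotate (T.rotate h1)⟩
    have tp : T.Adj t p := ⟨_, T.rotate h1⟩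
    have rq : T.Adj r q := ⟨_, T.rotate h2⟩
    have qt : T.Adj q t := ⟨_, T.rotate (T.rotate h2)⟩
    -- In the link of `p` the new neighbour `q` is entered from `r` and left towards `t`; in the
    -- link of `q`, the new neighbour `p` is entered from `t` and left towards `r`.
    have s1 : FlipTri T r t p q p r q := Or.inr (Or.inl (Or.inr (Or.inr ⟨rfl, rfl, rfl⟩)))
    have s2 : FlipTri T r t p q p q t := Or.inr (Or.inr (Or.inr (Or.inr ⟨rfl, rfl, rfl⟩)))
    have s3 : FlipTri T r t p q q p r := Or.inr (Or.inl (Or.inr (Or.inl ⟨rfl, rfl, rfl⟩)))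
    have s4 : FlipTri T r t p q q t p := Or.inr (Or.inr (Or.inl ⟨rfl, rfl, rfl⟩))
    rcases T.flipTri_old h1 h2 hb with ⟨k1, k2, k3⟩ | ⟨rfl, rfl⟩ | ⟨rfl, rfl⟩ <;>
      rcases T.flipTri_old h1 h2 hc with ⟨l1, l2, l3⟩ | ⟨m1, rfl⟩ | ⟨m1, rfl⟩
    · exact key' k3 l3 k1 k2 l1 l2
    · subst m1
      exact (key' k3 pr k1 k2 (by grind) (by grind)).tail s1
    · subst m1
      exact (key' k3 qt k1 k2 (by grind) (by grind)).tail s4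
    · exact (key' tp.symm l3 (by grind) (by grind) l1 l2).head s2
    · exact .refl
    · exact absurd m1 hpq
    · exact (key' rq.symm l3 (by grind) (by grind) l1 l2).head s3
    · exact absurd m1.symm hpq
    · exact .refl

theorem adj_flip (T : OrientedTriangulation V) {r t p q : V} (h1 : T.tri r t p)
    (h2 : T.tri t r q) (hpq : p ≠ q) (hn : ¬ T.Adj p q) {a b : V} :
    (T.flip h1 h2 hpq hn).Adj a b ↔ (¬ (a = r ∧ b = t) ∧ ¬ (a = t ∧ b = r) ∧ T.Adj a b) ∨
      (a = p ∧ b = q) ∨ (a = q ∧ b = p) :=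
  ⟨fun ⟨_, h⟩ => T.flipTri_old h1 h2 h, fun h => T.flipTri_exists h1 h2 h⟩

/-! ### Insertion of a vertex into a triangle -/

/-- The triangles after the insertion of the vertex `u` into the triangle `a b c`. -/
def InsertTri (T : OrientedTriangulation V) (a b c u x y z : V) : Prop :=
  (T.tri x y z ∧ ¬ Rotation a b c x y z) ∨
    Rotation a b u x y z ∨ Rotation b c u x y z ∨ Rotation c a u x y z

theorem insertTri_unique (T : OrientedTriangulation V) {a b c u : V} (h : T.tri a b c)
    (hu : ∀ x, ¬ T.Adj u x) {x y z w : V} (hz : InsertTri T a b c u x y z)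
    (hw : InsertTri T a b c u x y w) : z = w := by
  have u1 : ∀ y z, ¬ T.tri u y z := fun y z hz => hu _ ⟨z, hz⟩
  have u2 : ∀ x z, ¬ T.tri x u z := fun y z hz => hu _ (Adj.symm ⟨z, hz⟩)
  have a1 := T.ne_of_tri h
  have u : ∀ {a b c d}, T.tri a b c → T.tri a b d → c = d := T.unique
  have e1 := T.rotate h
  have e2 := T.rotate e1
  unfold InsertTri Rotation at hz hw
  rcases hz with h | (h | h | h) | (h | h | h) | (h | h | h) <;>
    rcases hw with h' | (h' | h' | h') | (h' | h' | h') | (h' | h' | h')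
  all_goals grind

theorem insertTri_old (T : OrientedTriangulation V) {a b c u : V} (h : T.tri a b c) {x y z : V}
    (hz : InsertTri T a b c u x y z) :
    T.Adj x y ∨ (x = u ∧ (y = a ∨ y = b ∨ y = c)) ∨ (y = u ∧ (x = a ∨ x = b ∨ x = c)) := by
  have A1 : T.Adj a b := ⟨_, h⟩
  have A2 : T.Adj b c := ⟨_, T.rotate h⟩
  have A3 : T.Adj c a := ⟨_, T.rotate (T.rotate h)⟩
  unfold InsertTri Rotation at hz
  rcases hz with h | (h | h | h) | (h | h | h) | (h | h | h)
  · exact Or.inl ⟨_, h.1⟩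
  all_goals grind

theorem insertTri_exists (T : OrientedTriangulation V) {a b c u : V} {x y : V}
    (hz : T.Adj x y ∨ (x = u ∧ (y = a ∨ y = b ∨ y = c)) ∨ (y = u ∧ (x = a ∨ x = b ∨ x = c))) :
    ∃ z, InsertTri T a b c u x y z := by
  rcases hz with ⟨z, hz⟩ | ⟨rfl, rfl | rfl | rfl⟩ | ⟨rfl, rfl | rfl | rfl⟩
  · by_cases k : Rotation a b c x y z
    · rcases k with ⟨rfl, rfl, rfl⟩ | ⟨rfl, rfl, rfl⟩ | ⟨rfl, rfl, rfl⟩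
      · exact ⟨u, Or.inr (Or.inl (Or.inl ⟨rfl, rfl, rfl⟩))⟩
      · exact ⟨u, Or.inr (Or.inr (Or.inl (Or.inl ⟨rfl, rfl, rfl⟩)))⟩
      · exact ⟨u, Or.inr (Or.inr (Or.inr (Or.inl ⟨rfl, rfl, rfl⟩)))⟩
    exact ⟨z, Or.inl ⟨hz, k⟩⟩
  · exact ⟨b, Or.inr (Or.inl (Or.inr (Or.inr ⟨rfl, rfl, rfl⟩)))⟩
  · exact ⟨c, Or.inr (Or.inr (Or.inl (Or.inr (Or.inr ⟨rfl, rfl, rfl⟩))))⟩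
  · exact ⟨a, Or.inr (Or.inr (Or.inr (Or.inr (Or.inr ⟨rfl, rfl, rfl⟩))))⟩
  · exact ⟨c, Or.inr (Or.inr (Or.inr (Or.inr (Or.inl ⟨rfl, rfl, rfl⟩))))⟩
  · exact ⟨a, Or.inr (Or.inl (Or.inr (Or.inl ⟨rfl, rfl, rfl⟩)))⟩
  · exact ⟨b, Or.inr (Or.inr (Or.inl (Or.inr (Or.inl ⟨rfl, rfl, rfl⟩))))⟩

/-- Only the step across the triangle `a b c` changes, and it becomes a detour through `u`. -/
theorem insertTri_link_step (T : OrientedTriangulation V) {a b c u : V} {x y z : V}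
    (h : T.tri x y z) : ReflTransGen (InsertTri T a b c u x) y z := by
  by_cases k : Rotation a b c x y z
  · rcases k with ⟨rfl, rfl, rfl⟩ | ⟨rfl, rfl, rfl⟩ | ⟨rfl, rfl, rfl⟩
    · exact .tail (.single (Or.inr (Or.inl (Or.inl ⟨rfl, rfl, rfl⟩))))
        (Or.inr (Or.inr (Or.inr (Or.inr (Or.inl ⟨rfl, rfl, rfl⟩)))))
    · exact .tail (.single (Or.inr (Or.inr (Or.inl (Or.inl ⟨rfl, rfl, rfl⟩)))))
        (Or.inr (Or.inl (Or.inr (Or.inl ⟨rfl, rfl, rfl⟩))))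
    · exact .tail (.single (Or.inr (Or.inr (Or.inr (Or.inl ⟨rfl, rfl, rfl⟩)))))
        (Or.inr (Or.inr (Or.inl (Or.inr (Or.inl ⟨rfl, rfl, rfl⟩)))))
  exact .single (Or.inl ⟨h, k⟩)

/-- The insertion of the isolated vertex `u` into the triangle `a b c`. -/
def insert (T : OrientedTriangulation V) {a b c u : V} (h : T.tri a b c)
    (hu : ∀ x, ¬ T.Adj u x) : OrientedTriangulation V where
  tri := InsertTri T a b c u
  rotate := by
    intro x y z h
    rcases h with ⟨h, k⟩ | h | h | h
    · exact Or.inl ⟨T.rotate h, fun k' => k k'.rotate.rotate⟩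
    · exact Or.inr (Or.inl h.rotate)
    · exact Or.inr (Or.inr (Or.inl h.rotate))
    · exact Or.inr (Or.inr (Or.inr h.rotate))
  unique := T.insertTri_unique h hu
  symm := by
    intro x y z hz
    refine T.insertTri_exists ?_
    rcases T.insertTri_old h hz with h | h | h
    · exact Or.inl h.symm
    · exact Or.inr (Or.inr h)
    · exact Or.inr (Or.inl h)
  irrefl := by
    intro x y hz
    have u0 : ∀ {z}, T.Adj z u → False := fun h => hu _ h.symm
    have A1 : T.Adj b a := Adj.symm ⟨_, h⟩
    have A2 : T.Adj c b := Adj.symm ⟨_, T.rotate h⟩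
    have A3 : T.Adj a c := Adj.symm ⟨_, T.rotate (T.rotate h)⟩
    rcases T.insertTri_old h hz with ⟨_, h⟩ | ⟨rfl, rfl | rfl | rfl⟩ | ⟨rfl, rfl | rfl | rfl⟩
    · exact T.irrefl h
    all_goals exact hu _ (by assumption)
  link := by
    intro x y z y' z' hy hz
    have key : ∀ {y z}, T.Adj x y → T.Adj x z → ReflTransGen (InsertTri T a b c u x) y z :=
      fun ⟨_, hy⟩ ⟨_, hz⟩ => by
        exact ReflTransGen.lift' (f := id)
          (fun _ _ h => T.insertTri_link_step h) _ _ (T.link hy hz)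
    have A1 : T.Adj b a := Adj.symm ⟨_, h⟩
    have A2 : T.Adj c b := Adj.symm ⟨_, T.rotate h⟩
    have A3 : T.Adj a c := Adj.symm ⟨_, T.rotate (T.rotate h)⟩
    have s1 : InsertTri T a b c u a b u := Or.inr (Or.inl (Or.inl ⟨rfl, rfl, rfl⟩))
    have s2 : InsertTri T a b c u b u a := Or.inr (Or.inl (Or.inr (Or.inl ⟨rfl, rfl, rfl⟩)))
    have s3 : InsertTri T a b c u u a b := Or.inr (Or.inl (Or.inr (Or.inr ⟨rfl, rfl, rfl⟩)))
    have s4 : InsertTri T a b c u b c u := Or.inr (Or.inr (Or.inl (Or.inl ⟨rfl, rfl, rfl⟩)))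
    have s5 : InsertTri T a b c u c u b :=
      Or.inr (Or.inr (Or.inl (Or.inr (Or.inl ⟨rfl, rfl, rfl⟩))))
    have s6 : InsertTri T a b c u u b c :=
      Or.inr (Or.inr (Or.inl (Or.inr (Or.inr ⟨rfl, rfl, rfl⟩))))
    have s7 : InsertTri T a b c u c a u := Or.inr (Or.inr (Or.inr (Or.inl ⟨rfl, rfl, rfl⟩)))
    have s8 : InsertTri T a b c u a u c :=
      Or.inr (Or.inr (Or.inr (Or.inr (Or.inl ⟨rfl, rfl, rfl⟩))))
    have s9 : InsertTri T a b c u u c a :=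
      Or.inr (Or.inr (Or.inr (Or.inr (Or.inr ⟨rfl, rfl, rfl⟩))))
    rcases T.insertTri_old h hy with h1 | ⟨rfl, h1⟩ | ⟨rfl, h1⟩
    · rcases T.insertTri_old h hz with h2 | ⟨rfl, h2⟩ | ⟨rfl, h2⟩
      · exact key h1 h2
      · exact absurd h1 (hu _)
      · rcases h2 with rfl | rfl | rfl
        · exact (key h1 A1.symm).tail s1
        · exact (key h1 A2.symm).tail s4
        · exact (key h1 A3.symm).tail s7
    · have r1 : ReflTransGen (InsertTri T a b c x x) y a := by
        rcases h1 with rfl | rfl | rfl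
        · exact .refl
        · exact .tail (.single s6) s9
        · exact .single s9
      refine r1.trans ?_
      rcases T.insertTri_old h hz with h2 | ⟨-, rfl | rfl | rfl⟩ | ⟨rfl, h2 | h2 | h2⟩
      · exact absurd h2 (hu _)
      · exact .refl
      · exact .single s3
      · exact .tail (.single s3) s6
      · exact absurd (h2 ▸ A1.symm) (hu _)
      · exact absurd (h2 ▸ A1) (hu _)
      · exact absurd (h2 ▸ A2) (hu _)
    · rcases T.insertTri_old h hz with h2 | ⟨rfl, h2⟩ | ⟨rfl, h2⟩
      · rcases h1 with rfl | rfl | rfl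
        · exact (key A3 h2).head s8
        · exact (key A1 h2).head s2
        · exact (key A2 h2).head s5
      · rcases h1 with rfl | rfl | rfl
        · exact absurd A3 (hu _)
        · exact absurd A1 (hu _)
        · exact absurd A2 (hu _)
      · exact .refl

theorem adj_insert (T : OrientedTriangulation V) {a b c u : V} (h : T.tri a b c)
    (hu : ∀ x, ¬ T.Adj u x) {x y : V} : (T.insert h hu).Adj x y ↔
      T.Adj x y ∨ (x = u ∧ (y = a ∨ y = b ∨ y = c)) ∨ (y = u ∧ (x = a ∨ x = b ∨ x = c)) :=
  ⟨fun ⟨_, hz⟩ => T.insertTri_old h hz, fun h => T.insertTri_exists h⟩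

end OrientedTriangulation

/-! ### From triangulations to rotation systems -/

theorem Equiv.Perm.SameCycle.map_eq {α β : Type*} {f : Equiv.Perm α} (g : α → β)
    (hg : ∀ x, g (f x) = g x) {x y : α} (h : f.SameCycle x y) : g x = g y := by
  obtain ⟨i, rfl⟩ := h
  have hg' : ∀ x, g (f⁻¹ x) = g x := fun x => by rw [← hg (f⁻¹ x)]; simp
  induction i with
  | zero => simp
  | succ n ih => rw [ih, add_comm, zpow_add, Equiv.Perm.mul_apply, zpow_one, hg]
  | pred n ih => rw [ih, sub_eq_neg_add, zpow_add, Equiv.Perm.mul_apply, zpow_neg_one, hg']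

namespace OrientedTriangulation

variable {V : Type} (T : OrientedTriangulation V)

/-- The third vertex of the triangle that contains a dart. -/
noncomputable def third (d : T.graph.Dart) : V := Exists.choose d.adj

theorem tri_third (d : T.graph.Dart) : T.tri d.fst d.snd (T.third d) :=
  Exists.choose_spec d.adj

/-- The rotation system of a triangulation: at the vertex `a`, the dart to `b` is followed by the
dart to `c` if `a b c` is a triangle. -/
noncomputable def rotation : Equiv.Perm T.graph.Dart where
  toFun d := ⟨(d.fst, T.third d), Adj.symm ⟨_, T.rotate (T.rotate (T.tri_third d))⟩⟩
  invFun d := ⟨(d.fst, T.third d.symm), ⟨d.snd, T.rotate (T.tri_third d.symm)⟩⟩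
  left_inv d := by
    ext
    · rfl
    · exact T.unique (T.tri_third (SimpleGraph.Dart.symm _)) (T.rotate (T.rotate (T.tri_third d)))
  right_inv d := by
    ext
    · rfl
    · exact T.unique (T.tri_third _) (T.rotate (T.tri_third d.symm))

theorem rotation_apply_eq {d d' : T.graph.Dart} (h : d.fst = d'.fst)
    (h' : T.tri d.fst d.snd d'.snd) : T.rotation d = d' := by
  ext
  · exact h
  · exact T.unique (T.tri_third d) h'

/-- The darts at a vertex form one cycle because the link is connected by directed walks: each step
of such a walk is one application of `rotation`. -/
noncomputable def rotationSystem : RotationSystem T.graph where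
  rot := T.rotation
  sameCycle_iff d d' := by
    refine ⟨fun h => h.map_eq (fun d => d.fst) fun _ => rfl, ?_⟩
    obtain ⟨⟨a, b⟩, hd⟩ := d
    obtain ⟨⟨a', c⟩, hd'⟩ := d'
    rintro rfl
    have key : ∀ x, ReflTransGen (T.tri a) b x → ∀ hx : T.graph.Adj a x,
        T.rotation.SameCycle ⟨(a, b), hd⟩ ⟨(a, x), hx⟩ := by
      intro x h
      induction h with
      | refl => exact fun _ => .refl _ _
      | @tail y z _ h ih =>
        intro hz
        have hy : T.graph.Adj a y := ⟨_, h⟩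
        rw [← T.rotation_apply_eq (d := ⟨(a, y), hy⟩) (d' := ⟨(a, z), hz⟩) rfl h]
        exact (Equiv.Perm.sameCycle_apply_right).2 (ih hy)
    obtain ⟨_, h1⟩ := id hd
    obtain ⟨_, h2⟩ := id hd'
    exact key c (T.link h1 h2) hd'

/-- Face tracing runs around the triangles against their orientation, whence `b a c` in the
hypothesis. -/
theorem faceTrace_apply_eq {a b c : V} (h : T.tri b a c) {d d' : T.graph.Dart}
    (hd : d.toProd = (a, b)) (hd' : d'.toProd = (b, c)) :
    T.rotationSystem.faceTrace d = d' := by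
  refine T.rotation_apply_eq (d := d.symm) ?_ ?_
  · simp [hd, hd']
  · simpa [hd, hd'] using h

/-- Face tracing permutes the three darts around a triangle cyclically. They are one orbit, since a
set whose membership is invariant under a permutation is a union of its cycles. -/
theorem isTriangular : T.rotationSystem.IsTriangular := by
  intro F
  obtain ⟨d, rfl⟩ := Quotient.exists_rep F
  obtain ⟨⟨a, b⟩, hd⟩ := d
  obtain ⟨c, h⟩ := Adj.symm hd
  have h1 := T.rotate h
  have h2 := T.rotate h1
  obtain ⟨n1, n2, n3⟩ := T.ne_of_tri h
  let d1 : T.graph.Dart := ⟨(a, b), hd⟩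
  let d2 : T.graph.Dart := ⟨(b, c), Adj.symm ⟨_, h2⟩⟩
  let d3 : T.graph.Dart := ⟨(c, a), Adj.symm ⟨_, h1⟩⟩
  have e1 : T.rotationSystem.faceTrace d1 = d2 := T.faceTrace_apply_eq h rfl rfl
  have e2 : T.rotationSystem.faceTrace d2 = d3 := T.faceTrace_apply_eq h2 rfl rfl
  have e3 : T.rotationSystem.faceTrace d3 = d1 := T.faceTrace_apply_eq h1 rfl rfl
  have key : {d : T.graph.Dart | Quotient.mk (Equiv.Perm.SameCycle.setoid
      T.rotationSystem.faceTrace) d = Quotient.mk _ d1} = {d1, d2, d3} := by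
    ext d
    rw [Set.mem_ofPred_eq, Quotient.eq]
    constructor
    · intro h
      have := h.symm.map_eq (fun d => d ∈ ({d1, d2, d3} : Set T.graph.Dart)) fun d => by
        simp only [Set.mem_insert_iff, Set.mem_singleton_iff, eq_iff_iff]
        constructor
        · rintro (h | h | h)
          · exact Or.inr (Or.inr (T.rotationSystem.faceTrace.injective (h.trans e3.symm)))
          · exact Or.inl (T.rotationSystem.faceTrace.injective (h.trans e1.symm))
          · exact Or.inr (Or.inl (T.rotationSystem.faceTrace.injective (h.trans e2.symm)))
        · rintro (rfl | rfl | rfl)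
          · exact Or.inr (Or.inl e1)
          · exact Or.inr (Or.inr e2)
          · exact Or.inl e3
      rw [← this]
      simp
    · have s1 : T.rotationSystem.faceTrace.SameCycle d2 d1 :=
        e1 ▸ Equiv.Perm.sameCycle_apply_left.2 (.refl _ _)
      have s2 : T.rotationSystem.faceTrace.SameCycle d3 d1 :=
        e2 ▸ Equiv.Perm.sameCycle_apply_left.2 s1
      rintro (rfl | rfl | rfl)
      · exact .refl _ _
      · exact s1
      · exact s2
  unfold RotationSystem.Face.sides
  change Set.ncard {d : T.graph.Dart | Quotient.mk (Equiv.Perm.SameCycle.setoid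
      T.rotationSystem.faceTrace) d = Quotient.mk _ d1} = 3
  rw [key, Set.ncard_eq_three]
  refine ⟨d1, d2, d3, ?_, ?_, ?_, rfl⟩ <;> intro h <;>
    have := congrArg (fun d : T.graph.Dart => d.fst) h
  · exact n1 this.symm
  · exact n2 this
  · exact n3 this.symm

theorem card_dart_eq [Finite V] (T : OrientedTriangulation V) :
    Nat.card T.graph.Dart = 3 * Nat.card T.rotationSystem.Face := by
  classical
  have := Fintype.ofFinite V
  have : Finite T.rotationSystem.Face := inferInstanceAs (Finite (Quotient _))
  have := Fintype.ofFinite T.rotationSystem.Face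
  let f : T.graph.Dart → T.rotationSystem.Face := Quotient.mk _
  have h : ∀ F, Nat.card {d // f d = F} = 3 := T.isTriangular
  rw [← Nat.card_congr (Equiv.sigmaFiberEquiv f), Nat.card_sigma]
  simp only [h]
  simp [mul_comm]

/-! ### Split-complete graphs and Euler's formula -/

/-- A triangulation whose graph arises from a complete graph by splitting one vertex into `u` and
`v` yields a split-complete graph with a triangular embedding. -/
theorem splitComplete_of_adj [Finite V] (T : OrientedTriangulation V) (s : ℕ) {u v : V}
    (huv : u ≠ v) (hV : Nat.card V = 12 * s + 7)
    (h1 : ∀ a b, a ≠ u → a ≠ v → b ≠ u → b ≠ v → a ≠ b → T.Adj a b)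
    (h2 : ∀ a, a ≠ u → a ≠ v → (T.Adj v a ↔ ¬ T.Adj u a)) (h3 : ¬ T.Adj u v)
    (hu : ∃ a, T.Adj u a) (hv : ∃ a, T.Adj v a) :
    IsSplitComplete (12 * s + 6) T.graph ∧ HasTriangularEmbedding T.graph := by
  classical
  have := Fintype.ofFinite V
  have hirr : ∀ a, ¬ T.Adj a a := fun a ⟨_, h⟩ => T.irrefl h
  have hne : ∀ {a b}, T.Adj a b → a ≠ b := fun h hab => hirr _ (hab ▸ h)
  rw [Nat.card_eq_fintype_card] at hV
  have hN : Fintype.card {a : V // a ≠ u ∧ a ≠ v} = 12 * s + 5 := by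
    rw [Fintype.card_subtype]
    have : (Finset.univ.filter fun a => a ≠ u ∧ a ≠ v) = Finset.univ \ {u, v} := by
      ext; simp
    rw [this, Finset.card_sdiff_of_subset (Finset.subset_univ _), Finset.card_univ, hV,
      Finset.card_pair huv]
    rfl
  let e : Fin (12 * s + 5) ≃ {a : V // a ≠ u ∧ a ≠ v} := (Fintype.equivFinOfCardEq hN).symm
  have hbij : Function.Bijective
      (Sum.elim (fun i => (e i : V)) (fun j : Fin 2 => if j = 0 then u else v)) := by
    constructor
    · rintro (i | i) (j | j) h
      · exact congrArg _ (e.injective (Subtype.ext h))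
      · have := (e i).2
        simp only [Sum.elim_inl, Sum.elim_inr] at h
        split_ifs at h <;> simp_all
      · have := (e j).2
        simp only [Sum.elim_inl, Sum.elim_inr] at h
        split_ifs at h <;> simp_all
      · simp only [Sum.elim_inr] at h
        congr 1
        fin_cases i <;> fin_cases j <;> simp_all
    · intro a
      by_cases ha : a = u
      · exact ⟨Sum.inr 0, by simp [ha]⟩
      by_cases hb : a = v
      · exact ⟨Sum.inr 1, by simp [hb]⟩
      · exact ⟨Sum.inl (e.symm ⟨a, ha, hb⟩), by simp⟩
  have hrange : Set.range (fun i => (e i : V)) = {a | a ≠ u ∧ a ≠ v} := by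
    ext a
    constructor
    · rintro ⟨i, rfl⟩
      exact (e i).2
    · intro ha
      exact ⟨e.symm ⟨a, ha⟩, by simp⟩
  -- The genus is forced: with `|V| = 12 * s + 7` and `2 * |E| = 3 * |F| = (12 * s + 5) * (12 * s +
  -- 6)`, Euler's formula reads `2 - 2 * g = 2 - 10 * s - 24 * s ^ 2`.
  refine ⟨⟨Equiv.ofBijective _ hbij, ?_⟩, 12 * s ^ 2 + 5 * s, T.rotationSystem, ⟨?_, ?_⟩,
    T.isTriangular⟩
  · change (∀ a ∈ Set.range (fun i => (e i : V)), ∀ b ∈ Set.range (fun i => (e i : V)),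
      a ≠ b → T.Adj a b) ∧ T.graph.neighborSet u ∪ T.graph.neighborSet v = _ ∧
      Disjoint (T.graph.neighborSet u) (T.graph.neighborSet v) ∧
      (T.graph.neighborSet u).Nonempty ∧ (T.graph.neighborSet v).Nonempty
    have hvu : ¬ T.Adj v u := fun h => h3 h.symm
    refine ⟨?_, ?_, ?_, hu, hv⟩
    · rw [hrange]
      exact fun a ha b hb => h1 a b ha.1 ha.2 hb.1 hb.2
    · refine Eq.trans ?_ hrange.symm
      ext a
      change T.Adj u a ∨ T.Adj v a ↔ _
      constructor
      · rintro (h | h)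
        · exact ⟨(hne h).symm, fun h' => h3 (h' ▸ h)⟩
        · exact ⟨fun h' => hvu (h' ▸ h), (hne h).symm⟩
      · intro ha
        rw [h2 a ha.1 ha.2]
        exact em _
    · rw [Set.disjoint_left]
      intro a (ha : T.Adj u a) (hb : T.Adj v a)
      exact (h2 a (hne ha).symm (hne hb).symm).1 hb ha
  · have hadj : ∀ {a b}, T.graph.Adj a b → T.graph.Reachable a b := fun h => h.reachable
    obtain ⟨a, ha⟩ := hu
    have hau : a ≠ u := (hne ha).symm
    have hav : a ≠ v := fun h => h3 (h ▸ ha)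
    have key : ∀ b, T.graph.Reachable a b := by
      have hn : ∀ b, b ≠ u → b ≠ v → T.graph.Reachable a b := by
        intro b hbu hbv
        by_cases hab : a = b
        · exact hab ▸ .refl _
        · exact hadj (h1 a b hau hav hbu hbv hab)
      intro b
      by_cases hbu : b = u
      · exact hbu ▸ hadj ha.symm
      by_cases hbv : b = v
      · obtain ⟨c, hc⟩ := hv
        exact hbv ▸ (hn c (fun h => h3 (h ▸ hc.symm)) (hne hc).symm).trans (hadj hc.symm)
      · exact hn b hbu hbv
    exact { preconnected := fun b c => (key b).symm.trans (key c), nonempty := ⟨a⟩ }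
  · have hdeg : ∀ a, a ≠ u → a ≠ v → T.graph.degree a = 12 * s + 5 := by
      intro a hau hav
      -- Here `w` is the one of `u` and `v` that is not adjacent to `a`; it is the only other vertex
      -- that `a` misses.
      obtain ⟨w, hw, hwa⟩ : ∃ w, w ≠ a ∧ T.graph.neighborFinset a = Finset.univ \ {a, w} := by
        have hsymm : ∀ x y, T.Adj x y ↔ T.Adj y x := fun x y => ⟨fun h => h.symm, fun h => h.symm⟩
        by_cases h : T.Adj u a
        · refine ⟨v, hav.symm, ?_⟩
          ext b
          rw [SimpleGraph.mem_neighborFinset]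
          change T.Adj a b ↔ _
          by_cases hbu : b = u
          · simp [hbu, h.symm, hau.symm, huv]
          by_cases hbv : b = v
          · simp only [hbv, Finset.mem_sdiff, Finset.mem_insert, Finset.mem_singleton, or_true,
              not_true, and_false, iff_false]
            exact fun h' => (h2 a hau hav).1 h'.symm h
          · by_cases hba : b = a
            · simp [hba, hirr]
            · simp [hbv, hba, h1 a b hau hav hbu hbv (Ne.symm hba)]
        · have h' := (h2 a hau hav).2 h
          refine ⟨u, hau.symm, ?_⟩
          ext b
          rw [SimpleGraph.mem_neighborFinset]
          change T.Adj a b ↔ _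
          by_cases hbv : b = v
          · simp [hbv, h'.symm, hav.symm, huv.symm]
          by_cases hbu : b = u
          · simp only [hbu, Finset.mem_sdiff, Finset.mem_insert, Finset.mem_singleton, or_true,
              not_true, and_false, iff_false]
            exact fun h' => h h'.symm
          · by_cases hba : b = a
            · simp [hba, hirr]
            · simp [hbu, hba, h1 a b hau hav hbu hbv (Ne.symm hba)]
      rw [← SimpleGraph.card_neighborFinset_eq_degree, hwa,
        Finset.card_sdiff_of_subset (Finset.subset_univ _), Finset.card_univ, hV,
        Finset.card_pair hw.symm]
      rfl
    have huvdeg : T.graph.degree u + T.graph.degree v = 12 * s + 5 := by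
      rw [← SimpleGraph.card_neighborFinset_eq_degree, ← SimpleGraph.card_neighborFinset_eq_degree,
        ← Finset.card_union_of_disjoint, ← hN, Fintype.card_subtype]
      · congr 1
        ext a
        simp only [Finset.mem_union, SimpleGraph.mem_neighborFinset, Finset.mem_filter,
          Finset.mem_univ, true_and]
        change T.Adj u a ∨ T.Adj v a ↔ _
        constructor
        · rintro (h | h)
          · exact ⟨(hne h).symm, fun h' => h3 (h' ▸ h)⟩
          · exact ⟨fun h' => h3 (h' ▸ h).symm, (hne h).symm⟩
        · intro ha
          rw [h2 a ha.1 ha.2]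
          exact em _
      · rw [Finset.disjoint_left]
        intro a ha hb
        rw [SimpleGraph.mem_neighborFinset] at ha hb
        exact (h2 a (hne ha).symm (hne hb).symm).1 hb ha
    have hsum : ∑ a, T.graph.degree a = (12 * s + 5) * (12 * s + 6) := by
      rw [← Finset.sum_sdiff (Finset.subset_univ {u, v}), Finset.sum_pair huv, huvdeg,
        Finset.sum_congr rfl (g := fun _ => 12 * s + 5), Finset.sum_const,
        Finset.card_sdiff_of_subset (Finset.subset_univ _), Finset.card_univ, hV,
        Finset.card_pair huv, smul_eq_mul]
      · rw [show 12 * s + 7 - 2 = 12 * s + 5 from rfl]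
        ring
      · intro a ha
        simp only [Finset.mem_sdiff, Finset.mem_insert, Finset.mem_singleton, not_or] at ha
        exact hdeg a ha.2.1 ha.2.2
    have hE : 2 * Nat.card T.graph.edgeSet = (12 * s + 5) * (12 * s + 6) := by
      rw [← hsum, T.graph.sum_degrees_eq_twice_card_edges, Nat.card_eq_fintype_card,
        ← SimpleGraph.edgeFinset_card]
    have hF : 3 * Nat.card T.rotationSystem.Face = (12 * s + 5) * (12 * s + 6) := by
      rw [← T.card_dart_eq, ← hsum, Nat.card_eq_fintype_card,
        SimpleGraph.dart_card_eq_sum_degrees]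
    rw [Nat.card_eq_fintype_card, hV]
    zify at hE hF
    push_cast
    linarith

end OrientedTriangulation

/-! ### A counting criterion for triangulations -/

namespace Relation

/-- A right-unique relation for which everything in sight is reached from `a`, including `a`
itself, is strongly connected. -/
theorem TransGen.reverse_of_rightUnique {α : Type*} {r : α → α → Prop}
    (hr : ∀ {x y z}, r x y → r x z → y = z) {a b : α} (ha : TransGen r a a) (hb : TransGen r a b) :
    TransGen r b a := by
  have key : ∀ {x y}, TransGen r x a → r x y → TransGen r y a := by
    intro x y hx hxy
    obtain ⟨z, hz, hza⟩ := TransGen.head'_iff.1 hx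
    rw [hr hxy hz]
    exact TransGen.trans_right hza ha
  induction hb with
  | single h => exact key ha h
  | tail _ h ih => exact key ih h

end Relation

namespace OrientedTriangulation

variable {V : Type}

/-- The sides of the triangles cover all directed edges of `D`, and by `hcard` there are not enough
sides to cover one twice or to leave `D`. So each directed edge of `D` lies in exactly one triangle,
the successor in each link is unique, and a walk through all neighbours closes up to a cycle. -/
theorem exists_of_card_le {ι : Type} [Finite V] [Finite ι] (t : ι → V × V × V)
    (D : V → V → Prop) (hs : ∀ a b, D a b → D b a) (hirr : ∀ a, ¬ D a a)
    (hcard : 3 * Nat.card ι ≤ Nat.card {p : V × V // D p.1 p.2}) (tri : V → V → V → Prop)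
    (htri : ∀ a b c, tri a b c ↔ ∃ i, Rotation (t i).1 (t i).2.1 (t i).2.2 a b c) (base : V → V)
    (hlink : ∀ a b, D a b → TransGen (tri a) (base a) b) :
    ∃ T : OrientedTriangulation V, T.tri = tri ∧ ∀ a b, T.Adj a b ↔ D a b := by
  classical
  have := Fintype.ofFinite V
  have := Fintype.ofFinite ι
  have hrot : ∀ a b c, tri a b c → tri b c a := fun a b c h => by
    rw [htri] at h ⊢
    exact h.imp fun i h => h.rotate
  let f : ι × Fin 3 → V × V := fun p =>
    ![((t p.1).1, (t p.1).2.1), ((t p.1).2.1, (t p.1).2.2), ((t p.1).2.2, (t p.1).1)] p.2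
  let g : ι × Fin 3 → V := fun p => ![(t p.1).2.2, (t p.1).1, (t p.1).2.1] p.2
  have hfg : ∀ {a b c}, tri a b c → ∃ p, f p = (a, b) ∧ g p = c := by
    intro a b c h
    obtain ⟨i, ⟨rfl, rfl, rfl⟩ | ⟨rfl, rfl, rfl⟩ | ⟨rfl, rfl, rfl⟩⟩ := (htri a b c).1 h
    exacts [⟨(i, 0), rfl, rfl⟩, ⟨(i, 1), rfl, rfl⟩, ⟨(i, 2), rfl, rfl⟩]
  have hf : ∀ p, tri (f p).1 (f p).2 (g p) := by
    rintro ⟨i, r⟩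
    rw [htri]
    refine ⟨i, ?_⟩
    fin_cases r
    exacts [Or.inl ⟨rfl, rfl, rfl⟩, Or.inr (Or.inl ⟨rfl, rfl, rfl⟩),
      Or.inr (Or.inr ⟨rfl, rfl, rfl⟩)]
  have hsub : (Finset.univ.filter fun p : V × V => D p.1 p.2) ⊆ Finset.univ.image f := by
    rintro ⟨a, b⟩ h
    -- The last step of the walk to `a` in the link of `b` is a triangle on the side `a b`.
    obtain ⟨c, -, hc⟩ := TransGen.tail'_iff.1 (hlink b a (hs _ _ (Finset.mem_filter.1 h).2))
    obtain ⟨p, hp, -⟩ := hfg (hrot _ _ _ (hrot _ _ _ hc))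
    exact Finset.mem_image.2 ⟨p, Finset.mem_univ _, hp⟩
  have hD : (Finset.univ.filter fun p : V × V => D p.1 p.2).card =
      Nat.card {p : V × V // D p.1 p.2} := by
    rw [Nat.card_eq_fintype_card, Fintype.card_subtype]
  have hι : (Finset.univ : Finset (ι × Fin 3)).card = 3 * Nat.card ι := by
    rw [Finset.card_univ, Fintype.card_prod, Fintype.card_fin, Nat.card_eq_fintype_card, mul_comm]
  have hle := Finset.card_image_le (s := Finset.univ) (f := f)
  have himg : Finset.univ.image f = Finset.univ.filter fun p : V × V => D p.1 p.2 :=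
    (Finset.eq_of_subset_of_card_le hsub (by omega)).symm
  have hinj : Function.Injective f := by
    rw [← Set.injOn_univ, ← Finset.coe_univ]
    exact Finset.card_image_iff.1 (le_antisymm hle (by rw [himg]; omega))
  have hadj : ∀ a b, (∃ c, tri a b c) ↔ D a b := by
    intro a b
    have := Finset.ext_iff.1 himg (a, b)
    simp only [Finset.mem_image, Finset.mem_univ, true_and, Finset.mem_filter] at this
    rw [← this]
    constructor
    · rintro ⟨c, h⟩
      exact (hfg h).imp fun p h => h.1
    · rintro ⟨p, h⟩
      have := hf p
      rw [h] at this
      exact ⟨_, this⟩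
  have huniq : ∀ {a b c d}, tri a b c → tri a b d → c = d := by
    intro a b c d h h'
    obtain ⟨p, hp, rfl⟩ := hfg h
    obtain ⟨q, hq, rfl⟩ := hfg h'
    rw [hinj (hp.trans hq.symm)]
  refine ⟨⟨tri, fun h => hrot _ _ _ h, huniq, fun h => ?_, fun {a b} h => ?_, ?_⟩, rfl, hadj⟩
  · exact (hadj _ _).2 (hs _ _ ((hadj _ _).1 ⟨_, h⟩))
  · exact hirr a ((hadj _ _).1 ⟨_, h⟩)
  · intro a b c x y hb hc
    have hb := hlink a b ((hadj _ _).1 ⟨_, hb⟩)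
    have hc := hlink a c ((hadj _ _).1 ⟨_, hc⟩)
    obtain ⟨z, hz, -⟩ := TransGen.head'_iff.1 hb
    -- The first step of a walk shows that `base a` is itself a neighbour of `a`, so it is reached
    -- from itself and the walk can be reversed.
    have ha := hlink a (base a) ((hadj _ _).1 ⟨_, hz⟩)
    exact ((TransGen.reverse_of_rightUnique (r := tri a) (fun h h' => huniq h h') ha hb).trans
      hc).to_reflTransGen

end OrientedTriangulation

/-! ### Symbolic labels and translation -/

namespace CyclicTriangulation

open OrientedTriangulation

/-- Vertex labels: numbers of the three classes, with values in `R`, and four letters. -/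
abbrev Label (R : Type) : Type := (Fin 3 × R) ⊕ Fin 4

/-- The number with value `x` in the class `i`. -/
abbrev num {R : Type} (i : Fin 3) (x : R) : Label R := Sum.inl (i, x)

/-- A letter. -/
abbrev letter {R : Type} (l : Fin 4) : Label R := Sum.inr l

/-- A triple of labels. -/
abbrev Triple (R : Type) : Type := Label R × Label R × Label R

/-- The triple `(a, b, c)` stands for `a * s + b + c * k`. -/
abbrev Form : Type := ℤ × ℤ × ℤ

namespace Form

def eval (s k : ℕ) (f : Form) : ℤ := f.1 * s + f.2.1 + f.2.2 * k

/-- The result of substituting `g` for `k` in `f`. -/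
def subst (g f : Form) : Form := (f.1 + f.2.2 * g.1, f.2.1 + f.2.2 * g.2.1, f.2.2 * g.2.2)

theorem eval_add (s k : ℕ) (f g : Form) : (f + g).eval s k = f.eval s k + g.eval s k := by
  simp only [eval, Prod.fst_add, Prod.snd_add]
  ring

theorem eval_sub (s k : ℕ) (f g : Form) : (f - g).eval s k = f.eval s k - g.eval s k := by
  simp only [eval, Prod.fst_sub, Prod.snd_sub]
  ring

theorem eval_subst {s k k' : ℕ} {f g : Form} (h : g.eval s k = k') :
    (subst g f).eval s k = f.eval s k' := by
  simp only [eval, subst] at h ⊢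
  rw [← h]
  ring

end Form

namespace Label

def map {R S : Type} (f : R → S) : Label R → Label S := Sum.map (Prod.map id f) id

/-- The equality of two labels modulo a subset of the values, given by its indicator. -/
def similar (z : Form → Bool) : Label Form → Label Form → Bool
  | .inl (i, f), .inl (j, g) => i == j && z (f - g)
  | .inr l, .inr m => l == m
  | _, _ => false

end Label

namespace Triple

def map {R S : Type} (f : R → S) (T : Triple R) : Triple S :=
  (Label.map f T.1, Label.map f T.2.1, Label.map f T.2.2)

def rotate {R : Type} (T : Triple R) : Triple R := (T.2.1, T.2.2, T.1)

/-- Whether `T` is a triangle whose first vertex is a number `x` of class `i`, and whose other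
vertices are `c + x` and `d + x`. -/
def isStepAt (z : Form → Bool) (i : Fin 3) (c d : Label Form) (T : Triple Form) : Bool :=
  match T.1 with
  | .inl (j, x) => j == i && (Label.map (· + x) c).similar z T.2.1 &&
      (Label.map (· + x) d).similar z T.2.2
  | .inr _ => false

end Triple

/-- Whether `c` and `d` are consecutive neighbours of the number `0` of class `i` in the triangles
of a list. -/
def isStep (z : Form → Bool) (L : List (Triple Form)) (i : Fin 3) (c d : Label Form) : Bool :=
  L.any fun T => T.isStepAt z i c d || T.rotate.isStepAt z i c d || T.rotate.rotate.isStepAt z i c d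

/-- The vertex with the integer label `c` translated by `v`. -/
def place {M : ℕ} (v : ZMod M) (c : Label ℤ) : Label (ZMod M) := 
  Label.map (fun x : ℤ => (x : ZMod M) + v) c

@[simp] theorem place_num {M : ℕ} (v : ZMod M) (i : Fin 3) (x : ℤ) :
    place v (num i x) = num i (x + v) := rfl

/-- The triangles that arise by translation from those of the list `B`. -/
def Tri (M : ℕ) (B : List (Triple ℤ)) (a b c : Label (ZMod M)) : Prop :=
  ∃ p : ZMod M × Fin B.length,
    Rotation (place p.1 B[p.2].1) (place p.1 B[p.2].2.1) (place p.1 B[p.2].2.2) a b c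

section

variable {M : ℕ} {B : List (Triple ℤ)}

theorem tri_of_mem {T : Triple ℤ} (h : T ∈ B) (v : ZMod M) :
    Tri M B (place v T.1) (place v T.2.1) (place v T.2.2) := by
  obtain ⟨i, rfl⟩ := List.mem_iff_get.1 h
  exact ⟨(v, i), Or.inl ⟨rfl, rfl, rfl⟩⟩

theorem Tri.rotate {a b c : Label (ZMod M)} (h : Tri M B a b c) : Tri M B b c a :=
  h.imp fun _ h => h.rotate

theorem place_eq_of_similar {z : Form → Bool} {s k : ℕ}
    (hz : ∀ f, z f = true → (M : ℤ) ∣ f.eval s k) {c d : Label Form} (h : c.similar z d = true)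
    (v : ZMod M) : place v (c.map (Form.eval s k)) = place v (d.map (Form.eval s k)) := by
  rcases c with ⟨i, f⟩ | l <;> rcases d with ⟨j, g⟩ | m <;> simp only [Label.similar,
    Bool.and_eq_true, beq_iff_eq, reduceCtorEq] at h
  · obtain ⟨rfl, h⟩ := h
    have := hz _ h
    rw [Form.eval_sub, ← ZMod.intCast_eq_intCast_iff_dvd_sub] at this
    change num i (((f.eval s k : ℤ) : ZMod M) + v) = num i (((g.eval s k : ℤ) : ZMod M) + v)
    rw [this]
  · rw [h]

theorem place_map_add (s k : ℕ) (x : Form) (c : Label Form) (v : ZMod M) :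
    place (v - ((x.eval s k : ℤ) : ZMod M)) ((Label.map (· + x) c).map (Form.eval s k)) =
      place v (c.map (Form.eval s k)) := by
  rcases c with ⟨i, f⟩ | l
  · change num i (((Form.eval s k (f + x) : ℤ) : ZMod M) + (v - ((x.eval s k : ℤ) : ZMod M))) =
      num i (((Form.eval s k f : ℤ) : ZMod M) + v)
    rw [Form.eval_add, Int.cast_add, add_assoc, add_sub_cancel]
  · rfl

/-- The translation by `v - x` moves the first vertex `x` of the triangle to `v`, and hence `c + x`
and `d + x` to `c + v` and `d + v`. Letters stay fixed. -/
theorem tri_of_isStepAt {z : Form → Bool} {s k : ℕ}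
    (hz : ∀ f, z f = true → (M : ℤ) ∣ f.eval s k) {i : Fin 3} {c d : Label Form} {T : Triple Form}
    (h : T.isStepAt z i c d = true)
    (hT : ∀ v : ZMod M, Tri M B (place v (T.1.map (Form.eval s k)))
      (place v (T.2.1.map (Form.eval s k))) (place v (T.2.2.map (Form.eval s k)))) (v : ZMod M) :
    Tri M B (num i v) (place v (c.map (Form.eval s k))) (place v (d.map (Form.eval s k))) := by
  obtain ⟨⟨j, x⟩ | l, T2, T3⟩ := T
  · simp only [Triple.isStepAt, Bool.and_eq_true, beq_iff_eq] at h
    obtain ⟨⟨rfl, h2⟩, h3⟩ := h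
    have := hT (v - ((x.eval s k : ℤ) : ZMod M))
    rw [← place_eq_of_similar hz h2, ← place_eq_of_similar hz h3, place_map_add,
      place_map_add] at this
    convert this using 1
    change _ = num j _
    simp
  · simp [Triple.isStepAt] at h

theorem tri_of_isStep {z : Form → Bool} {s k : ℕ}
    (hz : ∀ f, z f = true → (M : ℤ) ∣ f.eval s k) {L : List (Triple Form)}
    (hL : ∀ T ∈ L, T.map (Form.eval s k) ∈ B) {i : Fin 3} {c d : Label Form}
    (h : isStep z L i c d = true) (v : ZMod M) :
    Tri M B (num i v) (place v (c.map (Form.eval s k))) (place v (d.map (Form.eval s k))) := by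
  simp only [isStep, List.any_eq_true, Bool.or_eq_true] at h
  obtain ⟨T, hT, h⟩ := h
  have h1 := fun v : ZMod M => tri_of_mem (hL T hT) v
  rcases h with (h | h) | h
  · exact tri_of_isStepAt hz h h1 v
  · exact tri_of_isStepAt hz h (fun v => (h1 v).rotate) v
  · exact tri_of_isStepAt hz h (fun v => (h1 v).rotate.rotate) v

/-! ### Walks along links -/

/-- The label `c` occurs in the link of the number `v` of class `i`, after the letter `0`. -/
def Reach (B : List (Triple ℤ)) (i : Fin 3) (v : ZMod M) (c : Label ℤ) : Prop :=
  TransGen (Tri M B (num i v)) (letter 0) (place v c)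

/-- Consecutive elements of the list are consecutive neighbours. -/
def IsPath (z : Form → Bool) (L : List (Triple Form)) (i : Fin 3) (l : List (Label Form)) : Prop :=
  l.IsChain fun c d => isStep z L i c d = true

instance (z : Form → Bool) (L : List (Triple Form)) (i : Fin 3) (l : List (Label Form)) :
    Decidable (IsPath z L i l) := inferInstanceAs (Decidable (List.IsChain _ _))

theorem reach_of_isPath {z : Form → Bool} {s k : ℕ}
    (hz : ∀ f, z f = true → (M : ℤ) ∣ f.eval s k) {L : List (Triple Form)}
    (hL : ∀ T ∈ L, T.map (Form.eval s k) ∈ B) {i : Fin 3} (v : ZMod M) :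
    ∀ {l : List (Label Form)} {c : Label Form}, IsPath z L i (c :: l) →
      ReflTransGen (Tri M B (num i v)) (letter 0) (place v (c.map (Form.eval s k))) →
      ∀ d ∈ l, Reach B i v (d.map (Form.eval s k))
  | [], _, _, _, _, hd => by simp at hd
  | e :: l, c, h, hc, d, hd => by
    have h' := List.isChain_cons_cons.1 h
    have he : Reach B i v (e.map (Form.eval s k)) :=
      TransGen.tail' hc (tri_of_isStep hz hL h'.1 v)
    rcases List.mem_cons.1 hd with rfl | hd
    · exact he
    · exact reach_of_isPath hz hL v h'.2 he.to_reflTransGen d hd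

/-- The label at the next value of `k`. -/
def next (c : Label Form) : Label Form := c.map fun f => (f.1, f.2.1 + f.2.2, f.2.2)

theorem map_eval_next (s k : ℕ) (c : Label Form) :
    (next c).map (Form.eval s k) = c.map (Form.eval s (k + 1)) := by
  rcases c with ⟨i, f⟩ | l
  · simp only [next, Label.map, Sum.map_inl, Prod.map_apply, Form.eval]
    push_cast
    ring_nf
    rfl
  · rfl

/-- A single symbolic path from `c` to `next c`, checked with `k` as an indeterminate, is repeated
`n` times by induction. -/
theorem reach_run {z : Form → Bool} {s n : ℕ}
    (hz : ∀ k f, z f = true → (M : ℤ) ∣ f.eval s k) {L : List (Triple Form)}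
    (hL : ∀ k < n, ∀ T ∈ L, T.map (Form.eval s k) ∈ B) {i : Fin 3} (v : ZMod M)
    {l : List (Label Form)} {c : Label Form} (h : IsPath z L i (c :: (l ++ [next c])))
    (hc : Reach B i v (c.map (Form.eval s 0))) :
    (∀ k ≤ n, Reach B i v (c.map (Form.eval s k))) ∧
      ∀ k < n, ∀ d ∈ l, Reach B i v (d.map (Form.eval s k)) := by
  have h1 : ∀ k ≤ n, Reach B i v (c.map (Form.eval s k)) := by
    intro k hk
    induction k with
    | zero => exact hc
    | succ k ih =>
      rw [← map_eval_next]
      exact reach_of_isPath (hz k) (hL k hk) v h (ih (by omega)).to_reflTransGen _ (by simp)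
  exact ⟨h1, fun k hk d hd => reach_of_isPath (hz k) (hL k hk) v h (h1 k hk.le).to_reflTransGen d
    (by simp [hd])⟩

/-- The step along the link of a letter. -/
theorem transGen_letter [NeZero M] {l : Fin 4} {p q r : Fin 3} {x y z u : ZMod M}
    (h1 : ∀ v, Tri M B (letter l) (num p v) (num q (v + x)))
    (h2 : ∀ v, Tri M B (letter l) (num q v) (num r (v + y)))
    (h3 : ∀ v, Tri M B (letter l) (num r v) (num p (v + z)))
    (hu : u * (x + y + z) = 1) (hpqr : ∀ i : Fin 3, i = p ∨ i = q ∨ i = r) (w : ZMod M)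
    (i : Fin 3) (v : ZMod M) : TransGen (Tri M B (letter l)) (num p w) (num i v) := by
  have hstep : ∀ v, TransGen (Tri M B (letter l)) (num p v) (num p (v + (x + y + z))) := by
    intro v
    have := TransGen.tail (TransGen.tail (TransGen.single (h1 v)) (h2 _)) (h3 _)
    rwa [add_assoc, add_assoc, ← add_assoc x] at this
  have hn : ∀ n : ℕ, TransGen (Tri M B (letter l)) (num p w)
      (num p (w + ((n + 1 : ℕ) : ZMod M) * (x + y + z))) := by
    intro n
    induction n with
    | zero => simpa using hstep w
    | succ n ih =>
      have := ih.trans (hstep _)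
      rwa [add_assoc, ← add_one_mul, ← Nat.cast_succ] at this
  have hp : ∀ v, TransGen (Tri M B (letter l)) (num p w) (num p v) := by
    intro v
    -- One turn shifts by `x + y + z`, a unit with inverse `u`, so `(v - w) * u` turns are needed.
    -- The `- 1` is due to `hn`, which counts `n + 1` turns to keep the walk nonempty.
    have := hn ((v - w) * u - 1).val
    rw [Nat.cast_succ, ZMod.natCast_val, ZMod.cast_id, sub_add_cancel, mul_assoc, hu, mul_one,
      add_sub_cancel] at this
    exact this
  rcases hpqr i with rfl | rfl | rfl
  · exact hp v
  · simpa using (hp (v - x)).tail (h1 _)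
  · simpa using ((hp (v - y - x)).tail (h1 _)).tail (h2 _)

end

instance (c : Label Form) (l : List (Label Form)) : Decidable (c ∈ l) :=
  @List.instDecidableMemOfLawfulBEq _ instBEqOfDecidableEq _ c l

/-! ### The triangles of the cyclic triangulation -/

/-- The triangles that do not belong to a family. -/
def specialTriangles : List (Triple Form) := [
  (letter 0, num 0 (0, 0, 0), num 1 (1, 0, 0)), (letter 0, num 1 (0, 0, 0), num 2 (1, 1, 0)),
  (letter 0, num 2 (0, 0, 0), num 0 (4, 0, 0)),
  (num 0 (0, 0, 0), num 1 (3, 0, 0), num 2 (3, 1, 0)),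
  (letter 1, num 1 (3, 1, 0), num 0 (0, 0, 0)), (letter 1, num 2 (2, 1, 0), num 1 (0, 0, 0)),
  (letter 1, num 0 (1, 0, 0), num 2 (0, 0, 0)), (letter 2, num 1 (1, 0, 0), num 0 (0, 0, 0)),
  (letter 2, num 2 (1, 0, 0), num 1 (0, 0, 0)), (letter 2, num 0 (2, 0, 0), num 2 (0, 0, 0)),
  (num 0 (0, 0, 0), num 1 (2, 1, 0), num 1 (0, 0, 0)),
  (num 0 (0, 0, 0), num 1 (0, 0, 0), num 1 (4, 0, 0)),
  (num 0 (0, 0, 0), num 1 (4, 0, 0), num 1 (2, 0, 0)),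
  (num 0 (0, 0, 0), num 1 (2, 0, 0), num 1 (0, 1, 0)),
  (num 0 (0, 0, 0), num 1 (1, 1, 0), num 1 (3, 0, 0)),
  (num 1 (0, 0, 0), num 2 (2, 1, 0), num 2 (0, 0, 0)),
  (num 1 (0, 0, 0), num 2 (0, 0, 0), num 2 (4, 0, 0)),
  (num 1 (0, 0, 0), num 1 (0, 1, 0), num 2 (3, 1, 0)),
  (num 1 (0, 0, 0), num 2 (3, 1, 0), num 2 (1, 1, 0)),
  (num 1 (0, 0, 0), num 2 (2, 0, 0), num 2 (0, 1, 0)),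
  (num 2 (0, 0, 0), num 0 (2, 0, 0), num 0 (0, 1, 0)),
  (num 2 (0, 0, 0), num 2 (2, -1, 0), num 0 (3, 0, 0)),
  (num 2 (0, 0, 0), num 2 (0, 1, 0), num 0 (3, 1, 0)),
  (num 2 (0, 0, 0), num 0 (2, 1, 0), num 0 (0, 0, 0)),
  (num 2 (0, 0, 0), num 0 (0, 0, 0), num 0 (4, 0, 0)),
  (num 0 (0, 0, 0), num 0 (0, 1, 0), num 0 (2, 0, 0))]

/-- The families with `s - 1` triangles. -/
def longFamilies : List (Triple Form) := [
  (num 0 (0, 0, 0), num 1 (0, 1, 1), num 1 (2, -1, -1)),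
  (num 0 (0, 0, 0), num 0 (4, -1, -2), num 1 (3, -1, -1)),
  (num 1 (0, 0, 0), num 1 (2, 3, 2), num 2 (2, 2, 1)),
  (num 1 (0, 0, 0), num 2 (1, 0, -1), num 2 (1, 2, 1)),
  (num 2 (0, 0, 0), num 0 (0, 1, 1), num 0 (2, -1, -1)),
  (num 2 (0, 0, 0), num 2 (4, -1, -2), num 0 (3, -1, -1))]

/-- The families with `s - 2` triangles. -/
def shortFamilies : List (Triple Form) := [
  (num 0 (0, 0, 0), num 1 (2, -1, -1), num 1 (0, 2, 1)),
  (num 0 (0, 0, 0), num 1 (3, -1, -1), num 1 (3, 2, 1)),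
  (num 1 (0, 0, 0), num 2 (2, 2, 1), num 2 (4, -1, -1)),
  (num 1 (0, 0, 0), num 2 (1, 2, 1), num 2 (1, -1, -1)),
  (num 2 (0, 0, 0), num 0 (2, -1, -1), num 0 (0, 2, 1)),
  (num 2 (0, 0, 0), num 0 (3, -1, -1), num 0 (3, 2, 1))]

/-- The triangles of the triangulation up to translation. -/
def base (s : ℕ) : List (Triple ℤ) :=
  specialTriangles.map (Triple.map (Form.eval s 0)) ++
    longFamilies.flatMap (fun T => (List.range (s - 1)).map fun k => T.map (Form.eval s k)) ++
    shortFamilies.flatMap (fun T => (List.range (s - 2)).map fun k => T.map (Form.eval s k))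

/-- This is the number required by the edge count, `26 + 6 * (s - 1) + 6 * (s - 2)`. For `s = 1` the
truncated subtraction would spoil it. -/
theorem length_base {s : ℕ} (hs : 2 ≤ s) : (base s).length = 12 * s + 8 := by
  simp [base, specialTriangles, longFamilies, shortFamilies]
  omega

/-- The special triangles, and members of the families given by their indices. -/
def members (o e : List Form) : List (Triple Form) :=
  specialTriangles ++ longFamilies.flatMap (fun T => o.map fun g => T.map (Form.subst g)) ++
    shortFamilies.flatMap (fun T => e.map fun g => T.map (Form.subst g))

theorem Label.map_eval_subst {s k k' : ℕ} {g : Form} (h : g.eval s k = k') (c : Label Form) :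
    Label.map (Form.eval s k) (Label.map (Form.subst g) c) = Label.map (Form.eval s k') c := by
  rcases c with ⟨i, f⟩ | l
  · exact congrArg (num i) (Form.eval_subst h)
  · rfl

theorem Triple.map_eval_subst {s k k' : ℕ} {g : Form} (h : g.eval s k = k') (T : Triple Form) :
    Triple.map (Form.eval s k) (Triple.map (Form.subst g) T) = Triple.map (Form.eval s k') T := by
  simp only [Triple.map, Label.map_eval_subst h]

theorem specialTriangles_subst :
    ∀ T ∈ specialTriangles, Triple.map (Form.subst (0, 0, 0)) T = T := by
  simp [specialTriangles, Triple.map, Label.map, Form.subst]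

/-- The bounds say that the indices in `o` lie in the range `s - 1` of the long families, and those
in `e` in the range `s - 2` of the short ones. -/
theorem mem_base_of_mem_members {s k : ℕ} {o e : List Form}
    (ho : ∀ g ∈ o, 0 ≤ g.eval s k ∧ g.eval s k + 1 < s)
    (he : ∀ g ∈ e, 0 ≤ g.eval s k ∧ g.eval s k + 2 < s) :
    ∀ T ∈ members o e, T.map (Form.eval s k) ∈ base s := by
  intro T hT
  simp only [members, List.mem_append, List.mem_flatMap, List.mem_map] at hT
  simp only [base, List.mem_append, List.mem_flatMap, List.mem_map, List.mem_range]
  rcases hT with (hT | ⟨T, hT, g, hg, rfl⟩) | ⟨T, hT, g, hg, rfl⟩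
  · refine Or.inl (Or.inl ⟨T, hT, ?_⟩)
    rw [← specialTriangles_subst T hT, Triple.map_eval_subst (k' := 0) (by simp [Form.eval]),
      Triple.map_eval_subst (k' := 0) (by simp [Form.eval])]
  · obtain ⟨h₀, h₁⟩ := ho g hg
    exact Or.inl (Or.inr ⟨T, hT, (g.eval s k).toNat, by omega,
      (Triple.map_eval_subst (Int.toNat_of_nonneg h₀).symm T).symm⟩)
  · obtain ⟨h₀, h₁⟩ := he g hg
    exact Or.inr ⟨T, hT, (g.eval s k).toNat, by omega,
      (Triple.map_eval_subst (Int.toNat_of_nonneg h₀).symm T).symm⟩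

/-- The forms that are divisible by `4 * s + 1` for a formal reason. -/
def isMultiple (f : Form) : Bool := f.1 == 4 * f.2.1 && f.2.2 == 0

theorem dvd_of_isMultiple (s k : ℕ) (f : Form) (h : isMultiple f = true) :
    ((4 * s + 1 : ℕ) : ℤ) ∣ f.eval s k := by
  simp only [isMultiple, Bool.and_eq_true, beq_iff_eq] at h
  rw [Form.eval, h.1, h.2]
  exact ⟨f.2.1, by push_cast; ring⟩

/-! ### The links of the numbers -/

/-- The link of a number, cut into three paths and two periodic runs of `s + δ₁` and `s + δ₂`
periods. A run is given by the first label and the other labels of its period. -/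
structure LinkPath where
  path₁ : List (Label Form)
  run₁ : Label Form × List (Label Form)
  δ₁ : ℤ
  path₂ : List (Label Form)
  run₂ : Label Form × List (Label Form)
  δ₂ : ℤ
  path₃ : List (Label Form)

/-- The consecutive labels of the link are consecutive neighbours in triangles of the list `T`, or
`T₁` and `T₂` for the two runs. -/
def LinkPath.IsValid (P : LinkPath) (i : Fin 3) (T T₁ T₂ : List (Triple Form)) : Prop :=
  IsPath isMultiple T i (letter 0 :: (P.path₁ ++ [P.run₁.1.map (Form.subst (0, 0, 0))])) ∧
  IsPath isMultiple T₁ i (P.run₁.1 :: (P.run₁.2 ++ [next P.run₁.1])) ∧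
  IsPath isMultiple T i (P.run₁.1.map (Form.subst (1, P.δ₁, 0)) ::
    (P.path₂ ++ [P.run₂.1.map (Form.subst (0, 0, 0))])) ∧
  IsPath isMultiple T₂ i (P.run₂.1 :: (P.run₂.2 ++ [next P.run₂.1])) ∧
  IsPath isMultiple T i (P.run₂.1.map (Form.subst (1, P.δ₂, 0)) :: P.path₃)

instance (P : LinkPath) (i : Fin 3) (T T₁ T₂ : List (Triple Form)) :
    Decidable (P.IsValid i T T₁ T₂) := inferInstanceAs (Decidable (_ ∧ _))

/-- The five pieces are glued at the ends of the runs: a run begins at `k = 0` and ends at `k = s +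
δ`, which is again a form in `s` alone, so that the adjacent paths can be checked symbolically. -/
theorem LinkPath.IsValid.reach {P : LinkPath} {i : Fin 3} {T T₁ T₂ : List (Triple Form)}
    (hP : P.IsValid i T T₁ T₂) {M : ℕ} {B : List (Triple ℤ)} {s n₁ n₂ : ℕ} (hM : M = 4 * s + 1)
    (h₁ : (n₁ : ℤ) = s + P.δ₁) (h₂ : (n₂ : ℤ) = s + P.δ₂)
    (hT : ∀ t ∈ T, t.map (Form.eval s 0) ∈ B)
    (hT₁ : ∀ k < n₁, ∀ t ∈ T₁, t.map (Form.eval s k) ∈ B)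
    (hT₂ : ∀ k < n₂, ∀ t ∈ T₂, t.map (Form.eval s k) ∈ B) (v : ZMod M) :
    (∀ d ∈ P.path₁ ++ P.path₂ ++ P.path₃, Reach B i v (d.map (Form.eval s 0))) ∧
      (∀ k < n₁ + 1, Reach B i v (P.run₁.1.map (Form.eval s k))) ∧
      (∀ k < n₁, ∀ d ∈ P.run₁.2, Reach B i v (d.map (Form.eval s k))) ∧
      (∀ k < n₂ + 1, Reach B i v (P.run₂.1.map (Form.eval s k))) ∧
      (∀ k < n₂, ∀ d ∈ P.run₂.2, Reach B i v (d.map (Form.eval s k))) := by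
  subst hM
  have hz := dvd_of_isMultiple s
  obtain ⟨p1, p2, p3, p4, p5⟩ := hP
  have q1 := reach_of_isPath (hz 0) hT v p1 .refl
  have q2 := reach_run hz hT₁ v p2 (by
    rw [← Label.map_eval_subst (k := 0) (g := (0, 0, 0)) (by simp [Form.eval])]
    exact q1 _ (by simp))
  have q3 := reach_of_isPath (hz 0) hT v p3 (by
    rw [Label.map_eval_subst (k' := n₁) (by simp [Form.eval, h₁])]
    exact (q2.1 _ le_rfl).to_reflTransGen)
  have q4 := reach_run hz hT₂ v p4 (by
    rw [← Label.map_eval_subst (k := 0) (g := (0, 0, 0)) (by simp [Form.eval])]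
    exact q3 _ (by simp))
  have q5 := reach_of_isPath (hz 0) hT v p5 (by
    rw [Label.map_eval_subst (k' := n₂) (by simp [Form.eval, h₂])]
    exact (q4.1 _ le_rfl).to_reflTransGen)
  refine ⟨fun d hd => ?_, fun k hk => q2.1 k (by omega), q2.2, fun k hk => q4.1 k (by omega), q4.2⟩
  simp only [List.mem_append] at hd
  rcases hd with (hd | hd) | hd
  · exact q1 d (by simp [hd])
  · exact q3 d (by simp [hd])
  · exact q5 d hd

/-- The link of a number of class `0`. -/
def link0 : LinkPath where
  path₁ := [
    num 2 (0, 1, 0), num 0 (0, 1, 0), num 0 (2, 0, 0), num 2 (2, 0, 0), num 2 (0, 2, 0),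
    num 0 (2, 4, 0), num 2 (2, 2, 0), num 0 (2, 3, 0), num 1 (2, 1, 0), num 1 (0, 0, 0),
    num 1 (4, 0, 0), num 1 (2, 0, 0)]
  run₁ := (num 1 (0, 1, 1), [
    num 1 (2, -1, -1)])
  δ₁ := -2
  path₂ := [
    num 1 (1, 1, 0), num 1 (3, 0, 0), num 2 (3, 1, 0), letter 1, num 1 (3, 1, 0),
    num 0 (0, 2, 0), num 2 (3, 2, 0), num 0 (0, 3, 0), num 2 (1, 2, 0), num 2 (1, 0, 0),
    num 2 (1, 1, 0)]
  run₂ := (num 2 (3, 0, -1), [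
    num 0 (4, -1, -2), num 1 (3, -1, -1), num 1 (3, 2, 1), num 0 (0, 4, 2), num 2 (3, 3, 1),
    num 0 (0, 5, 2), num 2 (1, 3, 1), num 2 (1, -1, -1), num 0 (4, -2, -2)])
  δ₂ := -3
  -- The path ends at the letter `0` where the link began, so that this letter too is reached by a
  -- nonempty walk.
  path₃ := [
    num 0 (2, 5, 0), num 1 (2, 2, 0), num 1 (4, -1, 0), num 0 (2, -2, 0), num 2 (4, 0, 0),
    num 0 (2, -1, 0), num 0 (4, 0, 0), num 2 (0, 0, 0), num 0 (2, 1, 0), num 0 (2, 2, 0),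
    num 2 (2, 1, 0), letter 2, num 1 (1, 0, 0), letter 0]

/-- The link of a number of class `1`. -/
def link1 : LinkPath where
  path₁ := [
    num 0 (3, 1, 0), letter 2]
  run₁ := (num 2 (1, 0, -1), [
    num 2 (1, 2, 1)])
  δ₁ := -2
  path₂ := [
    num 2 (2, 0, 0), num 2 (0, 1, 0), num 0 (1, 1, 0), num 1 (2, 2, 0), num 0 (2, 1, 0),
    num 1 (2, 0, 0)]
  run₂ := (num 0 (2, 0, -1), [
    num 0 (0, 2, 1), num 1 (2, 4, 2), num 0 (2, 2, 1), num 1 (2, 3, 2), num 2 (2, 2, 1),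
    num 2 (4, -1, -1), num 1 (2, -4, -2), num 0 (4, -1, -1), num 1 (2, -3, -2)])
  δ₂ := -2
  path₃ := [
    num 0 (1, 0, 0), letter 1, num 2 (2, 1, 0), num 2 (0, 0, 0), num 2 (4, 0, 0),
    num 1 (2, -2, 0), num 0 (4, 0, 0), num 1 (2, -1, 0), num 0 (3, 0, 0), num 1 (4, -1, 0),
    num 2 (3, 0, 0), num 1 (4, 0, 0), num 0 (0, 0, 0), num 1 (2, 1, 0), num 0 (0, 1, 0),
    num 1 (0, 1, 0), num 2 (3, 1, 0), num 2 (1, 1, 0), letter 0]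

/-- The link of a number of class `2`. -/
def link2 : LinkPath where
  path₁ := [
    num 1 (3, 0, 0), num 2 (2, 0, 0), num 1 (2, 0, 0), letter 1, num 0 (1, 0, 0),
    num 1 (4, 0, 0), num 2 (2, -1, 0), num 0 (3, 0, 0), num 2 (4, 0, 0), num 1 (0, 0, 0),
    num 2 (2, 1, 0), num 1 (1, 0, 0)]
  run₁ := (num 1 (1, 1, 1), [
    num 1 (1, -1, -1), num 2 (4, -2, -2), num 1 (3, -1, -1), num 2 (4, -1, -2),
    num 0 (3, -1, -1), num 0 (3, 2, 1), num 2 (0, 4, 2), num 1 (3, 2, 1), num 2 (0, 3, 2)])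
  δ₁ := -2
  path₂ := [
    num 1 (0, 1, 0), num 2 (0, 1, 0), num 0 (3, 1, 0), num 2 (0, 2, 0), num 1 (3, 1, 0),
    letter 2, num 0 (2, 0, 0)]
  run₂ := (num 0 (0, 1, 1), [
    num 0 (2, -1, -1)])
  δ₂ := -2
  path₃ := [
    num 0 (1, 1, 0), num 2 (2, 2, 0), num 1 (2, 1, 0), num 2 (2, 3, 0), num 0 (2, 1, 0),
    num 0 (0, 0, 0), num 0 (4, 0, 0), letter 0]

/-- A finite check on formal expressions that serves all `s` and `k` at once. The lists give the
family indices needed; those such as `(1, -2, -1)`, that is `s - 2 - k`, run through a family from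
its end. -/
theorem link0_isValid : link0.IsValid 0
    (members [(0, 0, 0), (1, -2, 0), (0, 1, 0), (1, -3, 0)] [(0, 0, 0), (1, -3, 0)])
    (members [(0, 0, 1)] [(0, 0, 1)])
    (members [(0, 0, 1), (1, -3, -1), (0, 1, 1), (1, -2, -1)]
      [(0, 0, 1), (1, -3, -1), (0, 1, 1), (1, -4, -1)]) := by decide +kernel

theorem link1_isValid : link1.IsValid 1
    (members [(0, 0, 0), (1, -2, 0)] [])
    (members [(0, 0, 1)] [(0, 0, 1)])
    (members [(0, 0, 1), (1, -3, -1), (0, 1, 1), (1, -2, -1)]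
      [(0, 0, 1), (1, -3, -1)]) := by decide +kernel

theorem link2_isValid : link2.IsValid 2
    (members [(0, 0, 0), (1, -2, 0)] [])
    (members [(0, 0, 1), (1, -3, -1), (0, 1, 1), (1, -2, -1)]
      [(0, 0, 1), (1, -3, -1)])
    (members [(0, 0, 1)] [(0, 0, 1)]) := by decide +kernel

/-! ### The links contain all residues -/

section

variable {M : ℕ} {B : List (Triple ℤ)} {i : Fin 3} {v : ZMod M}

theorem Reach.eval {j : Fin 3} {s k : ℕ} {f : Form} {y : ℤ}
    (h : Reach B i v (Label.map (Form.eval s k) (num j f))) (e : f.1 * s + f.2.1 + f.2.2 * k = y) :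
    Reach B i v (num j y) := e ▸ h

variable {j : Fin 3} {s n : ℕ} {a b c : ℤ}

theorem reach_interval_up
    (h : ∀ k < n, Reach B i v (Label.map (Form.eval s k) (num j (a, b, 1)))) {y : ℤ}
    (h₁ : a * s + b ≤ y) (h₂ : y < a * s + b + n) : Reach B i v (num j y) :=
  (h (y - (a * s + b)).toNat (by omega)).eval (by simp only; omega)

theorem reach_interval_down
    (h : ∀ k < n, Reach B i v (Label.map (Form.eval s k) (num j (a, b, -1)))) {y : ℤ}
    (h₁ : a * s + b - n < y) (h₂ : y ≤ a * s + b) : Reach B i v (num j y) :=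
  (h (a * s + b - y).toNat (by omega)).eval (by simp only; omega)

/-- Two progressions of step two with adjacent first terms interleave to an interval; the quotient
by two gives the index `k` and the parity selects the progression. -/
theorem reach_interval_up_two
    (h : ∀ k < n, Reach B i v (Label.map (Form.eval s k) (num j (a, b, 2))))
    (h' : ∀ k < n, Reach B i v (Label.map (Form.eval s k) (num j (a, c, 2)))) (hc : c = b + 1)
    {y : ℤ} (h₁ : a * s + b ≤ y) (h₂ : y < a * s + b + 2 * n) : Reach B i v (num j y) := by
  subst hc
  obtain ⟨k, hk, e | e⟩ : ∃ k < n, y = a * s + b + 2 * (k : ℕ) ∨ y = a * s + b + 1 + 2 * (k : ℕ) :=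
    ⟨((y - (a * s + b)) / 2).toNat, by omega, by omega⟩
  · exact (h k hk).eval (by simp only; omega)
  · exact (h' k hk).eval (by simp only; omega)

theorem reach_interval_down_two
    (h : ∀ k < n, Reach B i v (Label.map (Form.eval s k) (num j (a, b, -2))))
    (h' : ∀ k < n, Reach B i v (Label.map (Form.eval s k) (num j (a, c, -2)))) (hc : c = b - 1)
    {y : ℤ} (h₁ : a * s + b - 2 * n < y) (h₂ : y ≤ a * s + b) : Reach B i v (num j y) := by
  subst hc
  obtain ⟨k, hk, e | e⟩ : ∃ k < n, y = a * s + b - 2 * (k : ℕ) ∨ y = a * s + b - 1 - 2 * (k : ℕ) :=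
    ⟨((a * s + b - y) / 2).toNat, by omega, by omega⟩
  · exact (h k hk).eval (by simp only; omega)
  · exact (h' k hk).eval (by simp only; omega)

end

/-- All other numbers, and all letters but the last, lie on the link of the number `v` of
class `i`. -/
def ReachesAll (s : ℕ) (i : Fin 3) (v : ZMod (4 * s + 1)) : Prop :=
  (∀ l : Fin 4, l ≠ 3 → Reach (base s) i v (letter l)) ∧
    ∀ (j : Fin 3) (y : ℤ), 0 ≤ y → y < 4 * s + 1 → (j = i → y ≠ 0) → Reach (base s) i v (num j y)

/-- The representatives in `0, …, 4 * s` are cut into single values, which lie on the fixed paths or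
are ends of a run, and intervals swept by the runs. The second run has `s - 3` periods, which is why
`s = 2` is excluded. -/
theorem reach_of_class0 {s : ℕ} (hs : 3 ≤ s) (v : ZMod (4 * s + 1)) :
    ReachesAll s 0 v := by
  obtain ⟨n₁, hn₁⟩ : ∃ n, s = n + 2 := ⟨s - 2, by omega⟩
  obtain ⟨n₂, hn₂⟩ : ∃ n, s = n + 3 := ⟨s - 3, by omega⟩
  obtain ⟨h1, h2, h3, h4, h5⟩ := link0_isValid.reach (B := base s) rfl (n₁ := n₁) (n₂ := n₂)
    (by simp only [link0]; omega) (by simp only [link0]; omega)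
    (mem_base_of_mem_members (by simp [Form.eval]; omega) (by simp [Form.eval]; omega))
    (fun k hk => mem_base_of_mem_members (by simp [Form.eval]; omega) (by simp [Form.eval]; omega))
    (fun k hk => mem_base_of_mem_members (by simp [Form.eval]; omega) (by simp [Form.eval]; omega))
    v
  refine ⟨fun l hl => ?_, fun j y hy₀ hy₁ hj => ?_⟩
  · fin_cases l
    exacts [h1 (letter 0) (by decide), h1 (letter 1) (by decide), h1 (letter 2) (by decide),
      absurd rfl hl]
  fin_cases j <;> simp only [Fin.reduceFinMk, Fin.mk_zero, Fin.mk_one, Fin.isValue, forall_const,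
    ne_eq] at hj ⊢
  · obtain h | h | h | h | h | h | h | h | h | h | h | h | h | h :
      y = 1 ∨ y = 2 ∨ y = 3 ∨ (4 ≤ y ∧ y ≤ 2 * s - 3) ∨ y = 2 * s - 2 ∨ y = 2 * s - 1 ∨
      y = 2 * s ∨ y = 2 * s + 1 ∨ y = 2 * s + 2 ∨ y = 2 * s + 3 ∨ y = 2 * s + 4 ∨
      y = 2 * s + 5 ∨ (2 * s + 6 ≤ y ∧ y ≤ 4 * s - 1) ∨ y = 4 * s := by omega
    · exact (h1 (num 0 (0, 1, 0)) (by decide)).eval (by simp only; omega)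
    · exact (h1 (num 0 (0, 2, 0)) (by decide)).eval (by simp only; omega)
    · exact (h1 (num 0 (0, 3, 0)) (by decide)).eval (by simp only; omega)
    · exact reach_interval_up_two (fun k hk => h5 k hk (num 0 (0, 4, 2)) (by decide))
        (fun k hk => h5 k hk (num 0 (0, 5, 2)) (by decide)) (by norm_num)
        (by omega) (by omega)
    · exact (h1 (num 0 (2, -2, 0)) (by decide)).eval (by simp only; omega)
    · exact (h1 (num 0 (2, -1, 0)) (by decide)).eval (by simp only; omega)
    · exact (h1 (num 0 (2, 0, 0)) (by decide)).eval (by simp only; omega)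
    · exact (h1 (num 0 (2, 1, 0)) (by decide)).eval (by simp only; omega)
    · exact (h1 (num 0 (2, 2, 0)) (by decide)).eval (by simp only; omega)
    · exact (h1 (num 0 (2, 3, 0)) (by decide)).eval (by simp only; omega)
    · exact (h1 (num 0 (2, 4, 0)) (by decide)).eval (by simp only; omega)
    · exact (h1 (num 0 (2, 5, 0)) (by decide)).eval (by simp only; omega)
    · exact reach_interval_down_two (fun k hk => h5 k hk (num 0 (4, -1, -2)) (by decide))
        (fun k hk => h5 k hk (num 0 (4, -2, -2)) (by decide)) (by norm_num)
        (by omega) (by omega)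
    · exact (h1 (num 0 (4, 0, 0)) (by decide)).eval (by simp only; omega)
  · obtain h | h | h | h | h | h | h | h | h | h | h | h | h | h :
      y = 0 ∨ (1 ≤ y ∧ y ≤ s - 1) ∨ y = s ∨ y = s + 1 ∨ (s + 2 ≤ y ∧ y ≤ 2 * s - 1) ∨
      y = 2 * s ∨ y = 2 * s + 1 ∨ y = 2 * s + 2 ∨ (2 * s + 3 ≤ y ∧ y ≤ 3 * s - 1) ∨ y = 3 * s ∨
      y = 3 * s + 1 ∨ (3 * s + 2 ≤ y ∧ y ≤ 4 * s - 2) ∨ y = 4 * s - 1 ∨ y = 4 * s := by omega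
    · exact (h1 (num 1 (0, 0, 0)) (by decide)).eval (by simp only; omega)
    · exact reach_interval_up h2 (by omega) (by omega)
    · exact (h1 (num 1 (1, 0, 0)) (by decide)).eval (by simp only; omega)
    · exact (h1 (num 1 (1, 1, 0)) (by decide)).eval (by simp only; omega)
    · exact reach_interval_down (fun k hk => h3 k hk (num 1 (2, -1, -1)) (by decide))
        (by omega) (by omega)
    · exact (h1 (num 1 (2, 0, 0)) (by decide)).eval (by simp only; omega)
    · exact (h1 (num 1 (2, 1, 0)) (by decide)).eval (by simp only; omega)
    · exact (h1 (num 1 (2, 2, 0)) (by decide)).eval (by simp only; omega)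
    · exact reach_interval_down (fun k hk => h5 k hk (num 1 (3, -1, -1)) (by decide))
        (by omega) (by omega)
    · exact (h1 (num 1 (3, 0, 0)) (by decide)).eval (by simp only; omega)
    · exact (h1 (num 1 (3, 1, 0)) (by decide)).eval (by simp only; omega)
    · exact reach_interval_up (fun k hk => h5 k hk (num 1 (3, 2, 1)) (by decide))
        (by omega) (by omega)
    · exact (h1 (num 1 (4, -1, 0)) (by decide)).eval (by simp only; omega)
    · exact (h1 (num 1 (4, 0, 0)) (by decide)).eval (by simp only; omega)
  · obtain h | h | h | h | h | h | h | h | h | h | h | h | h | h | h | h :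
      y = 0 ∨ y = 1 ∨ y = 2 ∨ (3 ≤ y ∧ y ≤ s - 1) ∨ y = s ∨ y = s + 1 ∨ y = s + 2 ∨
      (s + 3 ≤ y ∧ y ≤ 2 * s - 1) ∨ y = 2 * s ∨ y = 2 * s + 1 ∨ y = 2 * s + 2 ∨
      (2 * s + 3 ≤ y ∧ y ≤ 3 * s) ∨ y = 3 * s + 1 ∨ y = 3 * s + 2 ∨
      (3 * s + 3 ≤ y ∧ y ≤ 4 * s - 1) ∨ y = 4 * s := by omega
    · exact (h1 (num 2 (0, 0, 0)) (by decide)).eval (by simp only; omega)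
    · exact (h1 (num 2 (0, 1, 0)) (by decide)).eval (by simp only; omega)
    · exact (h1 (num 2 (0, 2, 0)) (by decide)).eval (by simp only; omega)
    · exact reach_interval_down (fun k hk => h5 k hk (num 2 (1, -1, -1)) (by decide))
        (by omega) (by omega)
    · exact (h1 (num 2 (1, 0, 0)) (by decide)).eval (by simp only; omega)
    · exact (h1 (num 2 (1, 1, 0)) (by decide)).eval (by simp only; omega)
    · exact (h1 (num 2 (1, 2, 0)) (by decide)).eval (by simp only; omega)
    · exact reach_interval_up (fun k hk => h5 k hk (num 2 (1, 3, 1)) (by decide))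
        (by omega) (by omega)
    · exact (h1 (num 2 (2, 0, 0)) (by decide)).eval (by simp only; omega)
    · exact (h1 (num 2 (2, 1, 0)) (by decide)).eval (by simp only; omega)
    · exact (h1 (num 2 (2, 2, 0)) (by decide)).eval (by simp only; omega)
    · exact reach_interval_down h4 (by omega) (by omega)
    · exact (h1 (num 2 (3, 1, 0)) (by decide)).eval (by simp only; omega)
    · exact (h1 (num 2 (3, 2, 0)) (by decide)).eval (by simp only; omega)
    · exact reach_interval_up (fun k hk => h5 k hk (num 2 (3, 3, 1)) (by decide))
        (by omega) (by omega)
    · exact (h1 (num 2 (4, 0, 0)) (by decide)).eval (by simp only; omega)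

theorem reach_of_class1 {s : ℕ} (hs : 2 ≤ s) (v : ZMod (4 * s + 1)) :
    ReachesAll s 1 v := by
  obtain ⟨n₁, hn₁⟩ : ∃ n, s = n + 2 := ⟨s - 2, by omega⟩
  obtain ⟨n₂, hn₂⟩ : ∃ n, s = n + 2 := ⟨s - 2, by omega⟩
  obtain ⟨h1, h2, h3, h4, h5⟩ := link1_isValid.reach (B := base s) rfl (n₁ := n₁) (n₂ := n₂)
    (by simp only [link1]; omega) (by simp only [link1]; omega)
    (mem_base_of_mem_members (by simp [Form.eval]; omega) (by simp [Form.eval]))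
    (fun k hk => mem_base_of_mem_members (by simp [Form.eval]; omega) (by simp [Form.eval]; omega))
    (fun k hk => mem_base_of_mem_members (by simp [Form.eval]; omega) (by simp [Form.eval]; omega))
    v
  refine ⟨fun l hl => ?_, fun j y hy₀ hy₁ hj => ?_⟩
  · fin_cases l
    exacts [h1 (letter 0) (by decide), h1 (letter 1) (by decide), h1 (letter 2) (by decide),
      absurd rfl hl]
  fin_cases j <;> simp only [Fin.reduceFinMk, Fin.mk_zero, Fin.mk_one, Fin.isValue, forall_const,
    ne_eq] at hj ⊢
  · obtain h | h | h | h | h | h | h | h | h | h | h | h :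
      y = 0 ∨ y = 1 ∨ (2 ≤ y ∧ y ≤ s - 1) ∨ y = s ∨ y = s + 1 ∨ (s + 2 ≤ y ∧ y ≤ 2 * s) ∨
      y = 2 * s + 1 ∨ (2 * s + 2 ≤ y ∧ y ≤ 3 * s - 1) ∨ y = 3 * s ∨ y = 3 * s + 1 ∨
      (3 * s + 2 ≤ y ∧ y ≤ 4 * s - 1) ∨ y = 4 * s := by omega
    · exact (h1 (num 0 (0, 0, 0)) (by decide)).eval (by simp only; omega)
    · exact (h1 (num 0 (0, 1, 0)) (by decide)).eval (by simp only; omega)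
    · exact reach_interval_up (fun k hk => h5 k hk (num 0 (0, 2, 1)) (by decide))
        (by omega) (by omega)
    · exact (h1 (num 0 (1, 0, 0)) (by decide)).eval (by simp only; omega)
    · exact (h1 (num 0 (1, 1, 0)) (by decide)).eval (by simp only; omega)
    · exact reach_interval_down h4 (by omega) (by omega)
    · exact (h1 (num 0 (2, 1, 0)) (by decide)).eval (by simp only; omega)
    · exact reach_interval_up (fun k hk => h5 k hk (num 0 (2, 2, 1)) (by decide))
        (by omega) (by omega)
    · exact (h1 (num 0 (3, 0, 0)) (by decide)).eval (by simp only; omega)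
    · exact (h1 (num 0 (3, 1, 0)) (by decide)).eval (by simp only; omega)
    · exact reach_interval_down (fun k hk => h5 k hk (num 0 (4, -1, -1)) (by decide))
        (by omega) (by omega)
    · exact (h1 (num 0 (4, 0, 0)) (by decide)).eval (by simp only; omega)
  · obtain h | h | h | h | h | h | h | h | h | h :
      y = 1 ∨ (2 ≤ y ∧ y ≤ 2 * s - 3) ∨ y = 2 * s - 2 ∨ y = 2 * s - 1 ∨ y = 2 * s ∨
      y = 2 * s + 1 ∨ y = 2 * s + 2 ∨ (2 * s + 3 ≤ y ∧ y ≤ 4 * s - 2) ∨ y = 4 * s - 1 ∨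
      y = 4 * s := by omega
    · exact (h1 (num 1 (0, 1, 0)) (by decide)).eval (by simp only; omega)
    · exact reach_interval_down_two (fun k hk => h5 k hk (num 1 (2, -3, -2)) (by decide))
        (fun k hk => h5 k hk (num 1 (2, -4, -2)) (by decide)) (by norm_num)
        (by omega) (by omega)
    · exact (h1 (num 1 (2, -2, 0)) (by decide)).eval (by simp only; omega)
    · exact (h1 (num 1 (2, -1, 0)) (by decide)).eval (by simp only; omega)
    · exact (h1 (num 1 (2, 0, 0)) (by decide)).eval (by simp only; omega)
    · exact (h1 (num 1 (2, 1, 0)) (by decide)).eval (by simp only; omega)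
    · exact (h1 (num 1 (2, 2, 0)) (by decide)).eval (by simp only; omega)
    · exact reach_interval_up_two (fun k hk => h5 k hk (num 1 (2, 3, 2)) (by decide))
        (fun k hk => h5 k hk (num 1 (2, 4, 2)) (by decide)) (by norm_num)
        (by omega) (by omega)
    · exact (h1 (num 1 (4, -1, 0)) (by decide)).eval (by simp only; omega)
    · exact (h1 (num 1 (4, 0, 0)) (by decide)).eval (by simp only; omega)
  · obtain h | h | h | h | h | h | h | h | h | h | h | h :
      y = 0 ∨ y = 1 ∨ (2 ≤ y ∧ y ≤ s) ∨ y = s + 1 ∨ (s + 2 ≤ y ∧ y ≤ 2 * s - 1) ∨ y = 2 * s ∨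
      y = 2 * s + 1 ∨ (2 * s + 2 ≤ y ∧ y ≤ 3 * s - 1) ∨ y = 3 * s ∨ y = 3 * s + 1 ∨
      (3 * s + 2 ≤ y ∧ y ≤ 4 * s - 1) ∨ y = 4 * s := by omega
    · exact (h1 (num 2 (0, 0, 0)) (by decide)).eval (by simp only; omega)
    · exact (h1 (num 2 (0, 1, 0)) (by decide)).eval (by simp only; omega)
    · exact reach_interval_down h2 (by omega) (by omega)
    · exact (h1 (num 2 (1, 1, 0)) (by decide)).eval (by simp only; omega)
    · exact reach_interval_up (fun k hk => h3 k hk (num 2 (1, 2, 1)) (by decide))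
        (by omega) (by omega)
    · exact (h1 (num 2 (2, 0, 0)) (by decide)).eval (by simp only; omega)
    · exact (h1 (num 2 (2, 1, 0)) (by decide)).eval (by simp only; omega)
    · exact reach_interval_up (fun k hk => h5 k hk (num 2 (2, 2, 1)) (by decide))
        (by omega) (by omega)
    · exact (h1 (num 2 (3, 0, 0)) (by decide)).eval (by simp only; omega)
    · exact (h1 (num 2 (3, 1, 0)) (by decide)).eval (by simp only; omega)
    · exact reach_interval_down (fun k hk => h5 k hk (num 2 (4, -1, -1)) (by decide))
        (by omega) (by omega)
    · exact (h1 (num 2 (4, 0, 0)) (by decide)).eval (by simp only; omega)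

theorem reach_of_class2 {s : ℕ} (hs : 2 ≤ s) (v : ZMod (4 * s + 1)) :
    ReachesAll s 2 v := by
  obtain ⟨n₁, hn₁⟩ : ∃ n, s = n + 2 := ⟨s - 2, by omega⟩
  obtain ⟨n₂, hn₂⟩ : ∃ n, s = n + 2 := ⟨s - 2, by omega⟩
  obtain ⟨h1, h2, h3, h4, h5⟩ := link2_isValid.reach (B := base s) rfl (n₁ := n₁) (n₂ := n₂)
    (by simp only [link2]; omega) (by simp only [link2]; omega)
    (mem_base_of_mem_members (by simp [Form.eval]; omega) (by simp [Form.eval]))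
    (fun k hk => mem_base_of_mem_members (by simp [Form.eval]; omega) (by simp [Form.eval]; omega))
    (fun k hk => mem_base_of_mem_members (by simp [Form.eval]; omega) (by simp [Form.eval]; omega))
    v
  refine ⟨fun l hl => ?_, fun j y hy₀ hy₁ hj => ?_⟩
  · fin_cases l
    exacts [h1 (letter 0) (by decide), h1 (letter 1) (by decide), h1 (letter 2) (by decide),
      absurd rfl hl]
  fin_cases j <;> simp only [Fin.reduceFinMk, Fin.mk_zero, Fin.mk_one, Fin.isValue, forall_const,
    ne_eq] at hj ⊢
  · obtain h | h | h | h | h | h | h | h | h | h | h | h :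
      y = 0 ∨ (1 ≤ y ∧ y ≤ s - 1) ∨ y = s ∨ y = s + 1 ∨ (s + 2 ≤ y ∧ y ≤ 2 * s - 1) ∨
      y = 2 * s ∨ y = 2 * s + 1 ∨ (2 * s + 2 ≤ y ∧ y ≤ 3 * s - 1) ∨ y = 3 * s ∨ y = 3 * s + 1 ∨
      (3 * s + 2 ≤ y ∧ y ≤ 4 * s - 1) ∨ y = 4 * s := by omega
    · exact (h1 (num 0 (0, 0, 0)) (by decide)).eval (by simp only; omega)
    · exact reach_interval_up h4 (by omega) (by omega)
    · exact (h1 (num 0 (1, 0, 0)) (by decide)).eval (by simp only; omega)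
    · exact (h1 (num 0 (1, 1, 0)) (by decide)).eval (by simp only; omega)
    · exact reach_interval_down (fun k hk => h5 k hk (num 0 (2, -1, -1)) (by decide))
        (by omega) (by omega)
    · exact (h1 (num 0 (2, 0, 0)) (by decide)).eval (by simp only; omega)
    · exact (h1 (num 0 (2, 1, 0)) (by decide)).eval (by simp only; omega)
    · exact reach_interval_down (fun k hk => h3 k hk (num 0 (3, -1, -1)) (by decide))
        (by omega) (by omega)
    · exact (h1 (num 0 (3, 0, 0)) (by decide)).eval (by simp only; omega)
    · exact (h1 (num 0 (3, 1, 0)) (by decide)).eval (by simp only; omega)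
    · exact reach_interval_up (fun k hk => h3 k hk (num 0 (3, 2, 1)) (by decide))
        (by omega) (by omega)
    · exact (h1 (num 0 (4, 0, 0)) (by decide)).eval (by simp only; omega)
  · obtain h | h | h | h | h | h | h | h | h | h | h | h :
      y = 0 ∨ y = 1 ∨ (2 ≤ y ∧ y ≤ s - 1) ∨ y = s ∨ (s + 1 ≤ y ∧ y ≤ 2 * s - 1) ∨ y = 2 * s ∨
      y = 2 * s + 1 ∨ (2 * s + 2 ≤ y ∧ y ≤ 3 * s - 1) ∨ y = 3 * s ∨ y = 3 * s + 1 ∨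
      (3 * s + 2 ≤ y ∧ y ≤ 4 * s - 1) ∨ y = 4 * s := by omega
    · exact (h1 (num 1 (0, 0, 0)) (by decide)).eval (by simp only; omega)
    · exact (h1 (num 1 (0, 1, 0)) (by decide)).eval (by simp only; omega)
    · exact reach_interval_down (fun k hk => h3 k hk (num 1 (1, -1, -1)) (by decide))
        (by omega) (by omega)
    · exact (h1 (num 1 (1, 0, 0)) (by decide)).eval (by simp only; omega)
    · exact reach_interval_up h2 (by omega) (by omega)
    · exact (h1 (num 1 (2, 0, 0)) (by decide)).eval (by simp only; omega)
    · exact (h1 (num 1 (2, 1, 0)) (by decide)).eval (by simp only; omega)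
    · exact reach_interval_down (fun k hk => h3 k hk (num 1 (3, -1, -1)) (by decide))
        (by omega) (by omega)
    · exact (h1 (num 1 (3, 0, 0)) (by decide)).eval (by simp only; omega)
    · exact (h1 (num 1 (3, 1, 0)) (by decide)).eval (by simp only; omega)
    · exact reach_interval_up (fun k hk => h3 k hk (num 1 (3, 2, 1)) (by decide))
        (by omega) (by omega)
    · exact (h1 (num 1 (4, 0, 0)) (by decide)).eval (by simp only; omega)
  · obtain h | h | h | h | h | h | h | h | h | h :
      y = 1 ∨ y = 2 ∨ (3 ≤ y ∧ y ≤ 2 * s - 2) ∨ y = 2 * s - 1 ∨ y = 2 * s ∨ y = 2 * s + 1 ∨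
      y = 2 * s + 2 ∨ y = 2 * s + 3 ∨ (2 * s + 4 ≤ y ∧ y ≤ 4 * s - 1) ∨ y = 4 * s := by omega
    · exact (h1 (num 2 (0, 1, 0)) (by decide)).eval (by simp only; omega)
    · exact (h1 (num 2 (0, 2, 0)) (by decide)).eval (by simp only; omega)
    · exact reach_interval_up_two (fun k hk => h3 k hk (num 2 (0, 3, 2)) (by decide))
        (fun k hk => h3 k hk (num 2 (0, 4, 2)) (by decide)) (by norm_num)
        (by omega) (by omega)
    · exact (h1 (num 2 (2, -1, 0)) (by decide)).eval (by simp only; omega)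
    · exact (h1 (num 2 (2, 0, 0)) (by decide)).eval (by simp only; omega)
    · exact (h1 (num 2 (2, 1, 0)) (by decide)).eval (by simp only; omega)
    · exact (h1 (num 2 (2, 2, 0)) (by decide)).eval (by simp only; omega)
    · exact (h1 (num 2 (2, 3, 0)) (by decide)).eval (by simp only; omega)
    · exact reach_interval_down_two (fun k hk => h3 k hk (num 2 (4, -1, -2)) (by decide))
        (fun k hk => h3 k hk (num 2 (4, -2, -2)) (by decide)) (by norm_num)
        (by omega) (by omega)
    · exact (h1 (num 2 (4, 0, 0)) (by decide)).eval (by simp only; omega)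

/-! ### The class `0` for `s = 2` -/

/-- The link of a number of class `0` for `s = 2`. -/
def shortLink0 : List (Label Form) := [
  num 2 (0, 1, 0), num 0 (0, 1, 0), num 0 (0, 4, 0), num 2 (0, 4, 0), num 2 (0, 2, 0),
  num 2 (0, 3, 0), num 2 (0, 6, 0), num 0 (0, 7, 0), num 1 (0, 5, 0), num 1 (0, 0, 0),
  num 1 (0, 8, 0), num 1 (0, 4, 0), num 1 (0, 1, 0), num 1 (0, 3, 0), num 1 (0, 6, 0),
  num 2 (0, 7, 0), letter 1, num 1 (0, 7, 0), num 0 (0, 2, 0), num 2 (0, 8, 0), num 0 (0, 3, 0),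
  num 0 (0, 8, 0), num 2 (0, 0, 0), num 0 (0, 5, 0), num 0 (0, 6, 0), num 2 (0, 5, 0), letter 2,
  num 1 (0, 2, 0), letter 0]

/-- The forms that are divisible by `9` for `s = 2`. -/
def isMultipleTwo (f : Form) : Bool := (2 * f.1 + f.2.1) % 9 == 0 && f.2.2 == 0

theorem shortLink0_isPath :
    IsPath isMultipleTwo (members [(0, 0, 0)] []) 0 (letter 0 :: shortLink0) := by decide +kernel

/-- The whole link is one explicit path modulo 9. Each long family has only its member of index `0`,
and the short families are empty. -/
theorem reach_of_class0_two (v : ZMod (4 * 2 + 1)) : ReachesAll 2 0 v := by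
  have h1 := reach_of_isPath (s := 2) (k := 0) (fun f hf => by
    simp only [isMultipleTwo, Bool.and_eq_true, beq_iff_eq] at hf
    simp only [Form.eval]
    omega) (mem_base_of_mem_members (by simp [Form.eval]) (by simp)) v shortLink0_isPath .refl
  refine ⟨fun l hl => ?_, fun j y hy₀ hy₁ hj => ?_⟩
  · fin_cases l
    exacts [h1 (letter 0) (by decide), h1 (letter 1) (by decide), h1 (letter 2) (by decide),
      absurd rfl hl]
  · have h2 : ∀ (j : Fin 3) (y : Fin 9), (j = 0 → y ≠ 0) →
        num j (0, ((y : ℕ) : ℤ), 0) ∈ shortLink0 := by decide +kernel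
    obtain ⟨n, rfl⟩ := Int.eq_ofNat_of_zero_le hy₀
    refine (h1 _ (h2 j ⟨n, by omega⟩ fun hj' h => hj hj' ?_)).eval (by simp)
    simpa using congrArg Fin.val h

theorem reachesAll {s : ℕ} (hs : 2 ≤ s) (i : Fin 3) (v : ZMod (4 * s + 1)) :
    ReachesAll s i v := by
  fin_cases i
  · rcases hs.eq_or_lt with rfl | hs
    · exact reach_of_class0_two v
    · exact reach_of_class0 hs v
  · exact reach_of_class1 hs v
  · exact reach_of_class2 hs v

/-! ### The cyclic triangulation -/

/-- The adjacency in the graph in which any two numbers are adjacent, and each letter but the last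
is adjacent to all numbers. -/
def Joined {R : Type} : Label R → Label R → Prop
  | .inl a, .inl b => a ≠ b
  | .inl _, .inr l => l ≠ 3
  | .inr l, .inl _ => l ≠ 3
  | .inr _, .inr _ => False

theorem Joined.symm {R : Type} {a b : Label R} (h : Joined a b) : Joined b a := by
  rcases a with a | a <;> rcases b with b | b
  exacts [Ne.symm h, h, h, h]

theorem not_joined_self {R : Type} (a : Label R) : ¬ Joined a a := by
  rcases a with a | a
  exacts [fun h => h rfl, fun h => h]

/-- With `m = Fintype.card R` there are `3 * m * (3 * m - 1)` ordered pairs of numbers and `2 * 3 *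
(3 * m)` pairs of a number and a letter. A lower bound is all that the counting criterion needs. -/
theorem card_joined_ge {R : Type} [Fintype R] :
    9 * Fintype.card R * Fintype.card R + 15 * Fintype.card R ≤
      Nat.card {p : Label R × Label R // Joined p.1 p.2} := by
  classical
  let g : {p : (Fin 3 × R) × (Fin 3 × R) // p.1 ≠ p.2} ⊕ (Bool × (Fin 3 × R) × Fin 3) →
      Label R × Label R := Sum.elim (fun p => (.inl p.1.1, .inl p.1.2)) (fun p =>
    if p.1 then (.inl p.2.1, .inr p.2.2.castSucc) else (.inr p.2.2.castSucc, .inl p.2.1))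
  have hg : Function.Injective g := by
    rintro (⟨⟨a, b⟩, h⟩ | ⟨_ | _, a, l⟩) (⟨⟨a', b'⟩, h'⟩ | ⟨_ | _, a', l'⟩) h <;>
      simp [g] at h <;> simp [h]
  have hj : ∀ p, Joined (g p).1 (g p).2 := by
    rintro (⟨⟨a, b⟩, h⟩ | ⟨_ | _, a, l⟩)
    exacts [h, l.castSucc_lt_last.ne, l.castSucc_lt_last.ne]
  have := Nat.card_le_card_of_injective
    (fun p => (⟨g p, hj p⟩ : {p : Label R × Label R // Joined p.1 p.2}))
    fun p q h => hg (congrArg Subtype.val h)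
  refine le_trans ?_ this
  have hne : Fintype.card {p : (Fin 3 × R) × (Fin 3 × R) // p.1 ≠ p.2} =
      3 * Fintype.card R * (3 * Fintype.card R) - 3 * Fintype.card R := by
    rw [Fintype.card_subtype]
    have : (Finset.univ.filter fun p : (Fin 3 × R) × (Fin 3 × R) => p.1 ≠ p.2) =
        Finset.univ.offDiag := by
      ext; simp
    rw [this, Finset.offDiag_card, Finset.card_univ, Fintype.card_prod, Fintype.card_fin]
  rw [Nat.card_eq_fintype_card, Fintype.card_sum, hne]
  simp only [Fintype.card_prod, Fintype.card_bool, Fintype.card_fin]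
  rw [show 3 * Fintype.card R * (3 * Fintype.card R) =
    9 * Fintype.card R * Fintype.card R by ring]
  omega

theorem tri_special {s : ℕ} {T : Triple Form} (h : T ∈ specialTriangles) (v : ZMod (4 * s + 1)) :
    Tri (4 * s + 1) (base s) (place v (T.1.map (Form.eval s 0)))
      (place v (T.2.1.map (Form.eval s 0))) (place v (T.2.2.map (Form.eval s 0))) := by
  refine tri_of_mem (T := T.map (Form.eval s 0)) ?_ v
  simp only [base, List.mem_append, List.mem_map]
  exact Or.inl (Or.inl ⟨T, h, rfl⟩)

theorem tri_special_of_eq {s : ℕ} (n : ℕ) {T : Triple Form} (h : specialTriangles[n]? = some T)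
    (v : ZMod (4 * s + 1)) {a b c : Label (ZMod (4 * s + 1))}
    (ha : place v (T.1.map (Form.eval s 0)) = a) (hb : place v (T.2.1.map (Form.eval s 0)) = b)
    (hc : place v (T.2.2.map (Form.eval s 0)) = c) : Tri (4 * s + 1) (base s) a b c := by
  subst ha hb hc
  exact tri_special (List.mem_of_getElem? h) v

theorem natCast_four_mul_add_one (s : ℕ) : (4 * s + 1 : ZMod (4 * s + 1)) = 0 := by
  have := ZMod.natCast_self (4 * s + 1)
  push_cast at this
  exact this

/-- One turn through the three classes shifts by `6 * σ + 1`, `-(6 * σ + 2)` and `-(4 * σ)` for the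
letters `0`, `1`, `2`. As `4 * σ = -1`, these are units with inverses `-2 = 8 * σ`, `-2` and `1`, so
the link is a single cycle through all numbers. -/
theorem transGen_letter_num {s : ℕ} {l : Fin 4} (hl : l ≠ 3) (i : Fin 3) (v : ZMod (4 * s + 1)) :
    TransGen (Tri (4 * s + 1) (base s) (letter l)) (num 0 0) (num i v) := by
  have h0 := natCast_four_mul_add_one s
  obtain ⟨σ, hσ⟩ : ∃ σ : ZMod (4 * s + 1), (s : ZMod (4 * s + 1)) = σ := ⟨_, rfl⟩
  rw [hσ] at h0
  have e : ∀ {i : Fin 3} {x y : ZMod (4 * s + 1)}, x = y → num i x = num i y := fun h => h ▸ rfl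
  fin_cases l
  · refine transGen_letter (p := 0) (q := 1) (r := 2) (x := σ) (y := σ + 1) (z := 4 * σ)
      (u := 8 * σ) (fun v => ?_) (fun v => ?_) (fun v => ?_) ?_ (by decide) 0 i v
    · exact tri_special_of_eq 0 rfl v rfl (e (by simp [Form.eval]))
        (e (by simp [Form.eval, hσ]; ring))
    · exact tri_special_of_eq 1 rfl v rfl (e (by simp [Form.eval]))
        (e (by simp [Form.eval, hσ]; ring))
    · exact tri_special_of_eq 2 rfl v rfl (e (by simp [Form.eval]))
        (e (by simp [Form.eval, hσ]; ring))
    · linear_combination (12 * σ - 1) * h0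
  · refine transGen_letter (p := 0) (q := 2) (r := 1) (x := -σ) (y := -(2 * σ + 1))
      (z := -(3 * σ + 1)) (u := 8 * σ) (fun v => ?_) (fun v => ?_) (fun v => ?_) ?_ (by decide) 0
      i v
    · exact tri_special_of_eq 6 rfl (v - σ) rfl (e (by simp [Form.eval, hσ]))
        (e (by simp [Form.eval]; ring))
    · exact tri_special_of_eq 5 rfl (v - (2 * σ + 1)) rfl (e (by simp [Form.eval, hσ]))
        (e (by simp [Form.eval]; ring))
    · exact tri_special_of_eq 4 rfl (v - (3 * σ + 1)) rfl (e (by simp [Form.eval, hσ]))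
        (e (by simp [Form.eval]; ring))
    · linear_combination (-12 * σ - 1) * h0
  · refine transGen_letter (p := 0) (q := 2) (r := 1) (x := -(2 * σ)) (y := -σ)
      (z := -σ) (u := 1) (fun v => ?_) (fun v => ?_) (fun v => ?_) ?_ (by decide) 0 i v
    · exact tri_special_of_eq 9 rfl (v - 2 * σ) rfl (e (by simp [Form.eval, hσ]))
        (e (by simp [Form.eval]; ring))
    · exact tri_special_of_eq 8 rfl (v - σ) rfl (e (by simp [Form.eval, hσ]))
        (e (by simp [Form.eval]; ring))
    · exact tri_special_of_eq 7 rfl (v - σ) rfl (e (by simp [Form.eval, hσ]))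
        (e (by simp [Form.eval]; ring))
    · linear_combination -h0
  · exact absurd rfl hl

/-- The count is tight: `3 * (4 * s + 1) * (12 * s + 8)` is `9 * m ^ 2 + 15 * m` for `m = 4 * s +
1`. The fourth letter is isolated and is kept for the vertex to be inserted. -/
theorem exists_cyclic {s : ℕ} (hs : 2 ≤ s) :
    ∃ T : OrientedTriangulation (Label (ZMod (4 * s + 1))), T.tri = Tri (4 * s + 1) (base s) ∧
      ∀ a b, T.Adj a b ↔ Joined a b := by
  refine exists_of_card_le (ι := ZMod (4 * s + 1) × Fin (base s).length)
    (fun p => (place p.1 (base s)[p.2].1, place p.1 (base s)[p.2].2.1, place p.1 (base s)[p.2].2.2))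
    Joined (fun _ _ h => h.symm) not_joined_self ?_ _ (fun _ _ _ => Iff.rfl)
    (Sum.elim (fun _ => letter 0) fun _ => num 0 0) ?_
  · refine le_trans (le_of_eq ?_) card_joined_ge
    rw [Nat.card_prod, Nat.card_eq_fintype_card, ZMod.card, Nat.card_eq_fintype_card,
      Fintype.card_fin, length_base hs]
    ring
  · rintro (⟨i, v⟩ | l) (⟨j, w⟩ | m) h
    · have := (reachesAll hs i v).2 j ((w - v).val : ℤ) (by positivity)
        (by have := ZMod.val_lt (w - v); omega) (fun hij h0 => h (by
          have : w - v = 0 := by rwa [Nat.cast_eq_zero, ZMod.val_eq_zero] at h0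
          rw [hij, sub_eq_zero.1 this]))
      have e : place v (num j ((w - v).val : ℤ)) = num j w := by
        rw [place_num, Int.cast_natCast, ZMod.natCast_val, ZMod.cast_id, sub_add_cancel]
      rw [Reach, e] at this
      exact this
    · exact (reachesAll hs i v).1 m h
    · exact transGen_letter_num h j w
    · exact absurd h id

end CyclicTriangulation

/-! ### Four flips and an insertion -/

namespace OrientedTriangulation

variable {V : Type}

theorem tri_flip (T : OrientedTriangulation V) {r t p q : V} (h1 : T.tri r t p)
    (h2 : T.tri t r q) (hpq : p ≠ q) (hn : ¬ T.Adj p q) {a b c : V} (h : T.tri a b c)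
    (k1 : ¬ Rotation r t p a b c) (k2 : ¬ Rotation t r q a b c) :
    (T.flip h1 h2 hpq hn).tri a b c := Or.inl ⟨h, k1, k2⟩

/-- Four flips and an insertion turn a triangulation of a complete graph without the edges between
three letters, and with an isolated vertex `u`, into one of a split-complete graph. -/
theorem exists_split (T : OrientedTriangulation V) {x y z u a b b' c c' d : V}
    (hd : [x, y, z, u, a, b, b', c, c', d].Nodup)
    (hadj : ∀ p q, T.Adj p q ↔ p ≠ q ∧ p ≠ u ∧ q ≠ u ∧
      ¬ ((p = x ∨ p = y ∨ p = z) ∧ (q = x ∨ q = y ∨ q = z)))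
    (t1 : T.tri a b x) (t2 : T.tri b a z) (t3 : T.tri c c' a) (t4 : T.tri c' c b)
    (t5 : T.tri d b' c) (t6 : T.tri b' d c') (t7 : T.tri y a d) (t8 : T.tri a y b') :
    ∃ T' : OrientedTriangulation V,
      (∀ p q, p ≠ u → p ≠ y → q ≠ u → q ≠ y → p ≠ q → T'.Adj p q) ∧
      (∀ p, T'.Adj u p ↔ p = x ∨ p = z ∨ p = a) ∧
      (∀ p, p ≠ u → p ≠ y → (T'.Adj y p ↔ ¬ (p = x ∨ p = z ∨ p = a))) := by
  simp only [List.nodup_cons, List.mem_cons, not_or, List.not_mem_nil, not_false_eq_true,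
    List.nodup_nil, and_true] at hd
  have hxz : ¬ T.Adj x z := by rw [hadj]; grind
  -- The chain of flips is `ab` to `xz`, `cc'` to `ab`, `db'` to `cc'`, and `ya` to `db'`. Each of
  -- the last three restores the edge lost just before, which is therefore absent when it is added.
  let T₁ := T.flip t1 t2 (by grind) hxz
  have a₁ : ∀ p q, T₁.Adj p q ↔ _ := fun p q => T.adj_flip t1 t2 (by grind) hxz
  have keep₁ : ∀ {p q r}, T.tri p q r → ¬ Rotation a b x p q r → ¬ Rotation b a z p q r →
    T₁.tri p q r := T.tri_flip t1 t2 (by grind) hxz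
  have t3₁ : T₁.tri c c' a := keep₁ t3 (by unfold Rotation; grind) (by unfold Rotation; grind)
  have t4₁ : T₁.tri c' c b := keep₁ t4 (by unfold Rotation; grind) (by unfold Rotation; grind)
  have t5₁ : T₁.tri d b' c := keep₁ t5 (by unfold Rotation; grind) (by unfold Rotation; grind)
  have t6₁ : T₁.tri b' d c' := keep₁ t6 (by unfold Rotation; grind) (by unfold Rotation; grind)
  have t7₁ : T₁.tri y a d := keep₁ t7 (by unfold Rotation; grind) (by unfold Rotation; grind)
  have t8₁ : T₁.tri a y b' := keep₁ t8 (by unfold Rotation; grind) (by unfold Rotation; grind)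
  -- This face arises from the first flip and survives the others; it will receive `u`.
  have t9₁ : T₁.tri a z x := Or.inr (Or.inl (Or.inl ⟨rfl, rfl, rfl⟩))
  have hab : ¬ T₁.Adj a b := by rw [a₁]; grind
  let T₂ := T₁.flip t3₁ t4₁ (by grind) hab
  have a₂ : ∀ p q, T₂.Adj p q ↔ _ := fun p q => T₁.adj_flip t3₁ t4₁ (by grind) hab
  have keep₂ : ∀ {p q r}, T₁.tri p q r → ¬ Rotation c c' a p q r → ¬ Rotation c' c b p q r →
    T₂.tri p q r := T₁.tri_flip t3₁ t4₁ (by grind) hab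
  have t5₂ : T₂.tri d b' c := keep₂ t5₁ (by unfold Rotation; grind) (by unfold Rotation; grind)
  have t6₂ : T₂.tri b' d c' := keep₂ t6₁ (by unfold Rotation; grind) (by unfold Rotation; grind)
  have t7₂ : T₂.tri y a d := keep₂ t7₁ (by unfold Rotation; grind) (by unfold Rotation; grind)
  have t8₂ : T₂.tri a y b' := keep₂ t8₁ (by unfold Rotation; grind) (by unfold Rotation; grind)
  have t9₂ : T₂.tri a z x := keep₂ t9₁ (by unfold Rotation; grind) (by unfold Rotation; grind)
  have hc : ¬ T₂.Adj c c' := by rw [a₂]; grind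
  let T₃ := T₂.flip t5₂ t6₂ (by grind) hc
  have a₃ : ∀ p q, T₃.Adj p q ↔ _ := fun p q => T₂.adj_flip t5₂ t6₂ (by grind) hc
  have keep₃ : ∀ {p q r}, T₂.tri p q r → ¬ Rotation d b' c p q r → ¬ Rotation b' d c' p q r →
    T₃.tri p q r := T₂.tri_flip t5₂ t6₂ (by grind) hc
  have t7₃ : T₃.tri y a d := keep₃ t7₂ (by unfold Rotation; grind) (by unfold Rotation; grind)
  have t8₃ : T₃.tri a y b' := keep₃ t8₂ (by unfold Rotation; grind) (by unfold Rotation; grind)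
  have t9₃ : T₃.tri a z x := keep₃ t9₂ (by unfold Rotation; grind) (by unfold Rotation; grind)
  have hdb : ¬ T₃.Adj d b' := by rw [a₃]; grind
  let T₄ := T₃.flip t7₃ t8₃ (by grind) hdb
  have a₄ : ∀ p q, T₄.Adj p q ↔ _ := fun p q => T₃.adj_flip t7₃ t8₃ (by grind) hdb
  have t9₄ : T₄.tri a z x := T₃.tri_flip t7₃ t8₃ (by grind) hdb t9₃ (by unfold Rotation; grind)
    (by unfold Rotation; grind)
  -- The net effect of the flips is to gain `xz` and lose `ya`. So, apart from the isolated `u`,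
  -- only `yx`, `yz`, `ya` are missing.
  have key : ∀ p q, T₄.Adj p q ↔ p ≠ q ∧ p ≠ u ∧ q ≠ u ∧
      ¬ (p = y ∧ (q = x ∨ q = z ∨ q = a)) ∧ ¬ (q = y ∧ (p = x ∨ p = z ∨ p = a)) := by
    intro p q
    rw [a₄, a₃, a₂, a₁, hadj]
    clear keep₁ keep₂ keep₃ a₁ a₂ a₃ a₄ hadj
    clear t9₄ hdb T₄ t7₃ t8₃ t9₃ hc T₃ t5₂ t6₂ t7₂ t8₂ t9₂ hab T₂ t3₁ t4₁ t5₁ t6₁ t7₁ t8₁ t9₁ T₁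
    clear hxz t1 t2 t3 t4 t5 t6 t7 t8
    grind (splits := 30)
  have hu : ∀ p, ¬ T₄.Adj u p := fun p => by simp [key]
  have a₅ : ∀ p q, (T₄.insert t9₄ hu).Adj p q ↔ _ := fun p q => T₄.adj_insert t9₄ hu
  refine ⟨T₄.insert t9₄ hu, ?_, ?_, ?_⟩
  · intro p q h1 h2 h3 h4 h5
    rw [a₅, key]
    grind
  · intro p
    rw [a₅, key]
    grind
  · intro p h1 h2
    rw [a₅, key]
    grind

end OrientedTriangulation

namespace CyclicTriangulation

open OrientedTriangulation

theorem exists_splitComplete {s : ℕ} (hs : 2 ≤ s) :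
    ∃ (V : Type) (_ : Finite V) (G : SimpleGraph V),
      IsSplitComplete (12 * s + 6) G ∧ HasTriangularEmbedding G := by
  obtain ⟨T, hT, hadj⟩ := exists_cyclic hs
  have h0 := natCast_four_mul_add_one s
  have h1 : (1 : ZMod (4 * s + 1)) ≠ 0 := by
    intro h
    have := Nat.le_of_dvd one_pos ((ZMod.natCast_eq_zero_iff 1 (4 * s + 1)).1 (by simpa using h))
    omega
  have h3 : (3 : ZMod (4 * s + 1)) ≠ 0 := by
    intro h
    have := Nat.le_of_dvd (by norm_num)
      ((ZMod.natCast_eq_zero_iff 3 (4 * s + 1)).1 (by simpa using h))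
    omega
  have e : ∀ {i : Fin 3} {x y : ZMod (4 * s + 1)}, x = y → num i x = num i y := fun h => h ▸ rfl
  obtain ⟨σ, hσ⟩ : ∃ σ : ZMod (4 * s + 1), (s : ZMod (4 * s + 1)) = σ := ⟨_, rfl⟩
  rw [hσ] at h0
  -- Since `4 * σ = -1`, equality in these three cases would give `1 = 0`, `3 = 0` and `1 = 0`
  -- respectively.
  have n1 : σ ≠ 3 * σ + 1 := fun h => h1 (by linear_combination (-2) * h - h0)
  have n2 : σ + 1 ≠ 3 * σ := fun h => h3 (by linear_combination 2 * h + h0)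
  have n3 : σ ≠ 3 * σ := fun h => h1 (by linear_combination 2 * h + h0)
  -- All eight triangles are translates of special triangles, selected below by their positions
  -- counted from zero. The shifts move them to a common configuration around the number `0` of
  -- class `0`, using `4 * σ + 1 = 0`.
  obtain ⟨T', k1, k2, k3⟩ := T.exists_split (x := letter 0) (y := letter 1) (z := letter 2)
    (u := letter 3) (a := num 0 0) (b := num 1 σ) (b' := num 1 (3 * σ + 1)) (c := num 2 (σ + 1))
    (c' := num 2 (3 * σ)) (d := num 2 (3 * σ + 1))
    (by simp [n1, n2, n3, h1])
    (by
      rintro (p | p) (q | q) <;> rw [hadj]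
      · simp [Joined]
      · fin_cases q <;> simp [Joined]
      · fin_cases p <;> simp [Joined]
      · fin_cases p <;> fin_cases q <;> simp [Joined])
    (hT ▸ (tri_special_of_eq 0 rfl 0 rfl (e (by simp [Form.eval]))
      (e (by simp [Form.eval, hσ]))).rotate)
    (hT ▸ (tri_special_of_eq 7 rfl 0 rfl (e (by simp [Form.eval, hσ]))
      (e (by simp [Form.eval]))).rotate)
    (hT ▸ tri_special_of_eq 21 rfl (σ + 1) (e (by simp [Form.eval]))
      (e (by simp [Form.eval, hσ]; ring))
      (e (by simp [Form.eval, hσ]; linear_combination h0)))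
    (hT ▸ (tri_special_of_eq 19 rfl σ (e (by simp [Form.eval]))
      (e (by simp [Form.eval, hσ]; ring)) (e (by simp [Form.eval]; ring))).rotate)
    (hT ▸ (tri_special_of_eq 15 rfl (3 * σ + 1) (e (by simp [Form.eval]))
      (e (by simp [Form.eval, hσ]; linear_combination h0))
      (e (by simp [Form.eval]))).rotate.rotate)
    (hT ▸ tri_special_of_eq 16 rfl (3 * σ + 1) (e (by simp [Form.eval]))
      (e (by simp [Form.eval])) (e (by simp [Form.eval, hσ]; linear_combination h0)))
    (hT ▸ tri_special_of_eq 6 rfl (-σ) rfl (e (by simp [Form.eval, hσ]))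
      (e (by simp [Form.eval]; linear_combination -h0)))
    (hT ▸ (tri_special_of_eq 4 rfl 0 rfl (e (by simp [Form.eval, hσ]))
      (e (by simp [Form.eval]))).rotate.rotate)
  refine ⟨_, inferInstance, T'.graph, T'.splitComplete_of_adj s (u := letter 3) (v := letter 1)
    (by simp) ?_ k1 (fun p h h' => ?_) ?_ ⟨letter 0, ?_⟩ ⟨num 1 0, ?_⟩⟩
  · rw [Nat.card_sum, Nat.card_prod, Nat.card_eq_fintype_card, Nat.card_eq_fintype_card,
      Nat.card_eq_fintype_card, ZMod.card, Fintype.card_fin, Fintype.card_fin]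
    ring
  · rw [k3 p h h', k2]
  · simp [k2]
  · simp [k2]
  · rw [k3 _ (by simp) (by simp)]
    simp

end CyclicTriangulation

/-! ### The case `s = 1` -/

theorem List.IsChain.transGen {α : Type*} {r : α → α → Prop} :
    ∀ {l : List α} {a : α}, (a :: l).IsChain r → ∀ b ∈ l, TransGen r a b
  | [], _, _, _, hb => by simp at hb
  | c :: l, a, h, b, hb => by
    obtain ⟨hac, h⟩ := List.isChain_cons_cons.1 h
    rcases List.mem_cons.1 hb with rfl | hb
    · exact .single hac
    · exact .head hac (h.transGen b hb)

namespace SmallTriangulation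

open OrientedTriangulation

/-- The rotations at the vertices of a triangulation with `19` vertices. -/
def rows : List (List ℕ) := [
  [1, 8, 9, 2, 3, 16, 14, 4, 18, 7, 11, 13, 6, 10, 12, 5, 15],
  [0, 15, 12, 17, 13, 10, 5, 16, 2, 6, 4, 9, 7, 14, 11, 3, 8],
  [0, 9, 6, 1, 16, 7, 5, 10, 8, 11, 17, 14, 13, 12, 15, 4, 3],
  [16, 0, 2, 4, 12, 6, 14, 15, 13, 17, 5, 8, 1, 11, 7, 9, 10],
  [0, 14, 8, 10, 11, 12, 3, 2, 15, 16, 5, 13, 9, 1, 6, 7, 18],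
  [8, 3, 17, 9, 14, 6, 11, 15, 0, 12, 13, 4, 16, 1, 10, 2, 7],
  [1, 2, 9, 11, 5, 14, 3, 12, 16, 8, 15, 17, 10, 0, 13, 7, 4],
  [4, 6, 13, 15, 8, 5, 2, 16, 12, 10, 14, 1, 9, 3, 11, 0, 18],
  [0, 1, 3, 5, 7, 15, 6, 16, 13, 11, 2, 10, 4, 14, 17, 12, 9],
  [0, 8, 12, 14, 5, 17, 15, 10, 3, 7, 1, 4, 13, 16, 11, 6, 2],
  [17, 16, 3, 9, 15, 11, 4, 8, 2, 5, 1, 13, 14, 7, 12, 0, 6],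
  [16, 17, 2, 8, 13, 0, 7, 3, 1, 14, 12, 4, 10, 15, 5, 6, 9],
  [0, 10, 7, 16, 6, 3, 4, 11, 14, 9, 8, 17, 1, 15, 2, 13, 5],
  [0, 11, 8, 16, 9, 4, 5, 12, 2, 14, 10, 1, 17, 3, 15, 7, 6],
  [15, 3, 6, 5, 9, 12, 11, 1, 7, 10, 13, 2, 17, 8, 4, 0, 16],
  [14, 16, 4, 2, 12, 1, 0, 5, 11, 10, 9, 17, 6, 8, 7, 13, 3],
  [15, 14, 0, 3, 10, 17, 11, 9, 13, 8, 6, 12, 7, 2, 1, 5, 4],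
  [10, 6, 15, 9, 5, 3, 13, 1, 12, 8, 14, 2, 11, 16],
  [4, 7, 0]]

/-- The rotation at a vertex. -/
def row (a : ℕ) : List ℕ := rows.getD a []

/-- The pairs of consecutive neighbours of a vertex. -/
def corners (a : ℕ) : List (ℕ × ℕ) := (row a).zip ((row a).rotate 1)

theorem nodup_row : ∀ a < 19, (row a).Nodup := by decide +kernel

theorem lt_of_mem_row : ∀ a < 19, ∀ b ∈ row a, b < 19 := by decide +kernel

theorem mem_row_symm : ∀ a < 19, ∀ b ∈ row a, a ∈ row b := by decide +kernel

theorem notMem_row : ∀ a < 19, a ∉ row a := by decide +kernel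

/-- This is the classical rule for triangular rotation systems: if `c` follows `b` at `a`, then `a`
follows `c` at `b`. -/
theorem mem_corners_rotate : ∀ a < 19, ∀ p ∈ corners a, (p.2, a) ∈ corners p.1 := by
  decide +kernel

theorem isChain_row : ∀ a < 19, ((row a).headD 0 :: (row a).rotate 1).IsChain
    fun b c => (b, c) ∈ corners a := by decide +kernel

theorem headD_mem_row : ∀ a < 19, (row a).headD 0 ∈ row a := by decide +kernel

theorem mem_row_of_mem_corners {a b c : ℕ} (h : (b, c) ∈ corners a) : b ∈ row a ∧ c ∈ row a :=
  ⟨(List.of_mem_zip h).1, List.mem_rotate.1 (List.of_mem_zip h).2⟩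

theorem unique_of_mem_corners {a b c d : ℕ} (ha : a < 19) (h : (b, c) ∈ corners a)
    (h' : (b, d) ∈ corners a) : c = d := by
  obtain ⟨i, hi, e⟩ := List.mem_iff_getElem.1 h
  obtain ⟨j, hj, e'⟩ := List.mem_iff_getElem.1 h'
  simp only [corners, List.getElem_zip, Prod.mk.injEq] at e e'
  have := ((nodup_row a ha).getElem_inj_iff).1 (e.1.trans e'.1.symm)
  subst this
  exact e.2.symm.trans e'.2

theorem exists_mem_corners {a b : ℕ} (h : b ∈ row a) : ∃ c, (b, c) ∈ corners a := by
  obtain ⟨i, hi, rfl⟩ := List.mem_iff_getElem.1 h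
  refine ⟨((row a).rotate 1)[i]'(by simpa using hi), List.mem_iff_getElem.2 ⟨i, ?_, ?_⟩⟩
  · simpa [corners] using hi
  · simp [corners]

theorem transGen_corners (a b : Fin 19) (hb : (b : ℕ) ∈ row a) :
    TransGen (fun b c : Fin 19 => ((b : ℕ), (c : ℕ)) ∈ corners a)
      (Fin.ofNat 19 ((row a).headD 0)) b := by
  have hf : ∀ {n : ℕ}, n ∈ row a → (Fin.ofNat 19 n : ℕ) = n := fun h =>
    Nat.mod_eq_of_lt (lt_of_mem_row a a.2 _ h)
  have h := (isChain_row a a.2).transGen b (List.mem_rotate.2 hb)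
  have := TransGen.lift (p := fun b c : Fin 19 => ((b : ℕ), (c : ℕ)) ∈ corners a) (Fin.ofNat 19)
    (fun b c h => by
      have h' := mem_row_of_mem_corners h
      change (_, _) ∈ _
      rwa [hf h'.1, hf h'.2]) _ _ h
  rwa [Function.onFun, Fin.ofNat_val_eq_self] at this

/-- The triangulation with the given rotations. -/
def triangulation : OrientedTriangulation (Fin 19) where
  tri a b c := ((b : ℕ), (c : ℕ)) ∈ corners a
  rotate {a b c} h := mem_corners_rotate a a.2 _ h
  unique {a b c d} h h' := Fin.ext (unique_of_mem_corners a.2 h h')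
  symm {a b c} h := by
    obtain ⟨d, hd⟩ :=
      exists_mem_corners (mem_row_symm a a.2 b (mem_row_of_mem_corners h).1)
    exact ⟨⟨d, lt_of_mem_row b b.2 d (mem_row_of_mem_corners hd).2⟩, hd⟩
  irrefl {a b} h := notMem_row a a.2 (mem_row_of_mem_corners h).1
  link := by
    intro a b c x y hb hc
    have h := headD_mem_row a a.2
    exact ((TransGen.reverse_of_rightUnique
      (r := fun b c : Fin 19 => ((b : ℕ), (c : ℕ)) ∈ corners a)
      (fun h h' => Fin.ext (unique_of_mem_corners a.2 h h'))
      (transGen_corners a (Fin.ofNat 19 _)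
        (Eq.subst (motive := fun n => n ∈ row a)
          (Nat.mod_eq_of_lt (lt_of_mem_row a a.2 _ h)).symm h))
      (transGen_corners a b (mem_row_of_mem_corners hb).1)).trans
      (transGen_corners a c (mem_row_of_mem_corners hc).1)).to_reflTransGen

theorem adj_triangulation (a b : Fin 19) : triangulation.Adj a b ↔ (b : ℕ) ∈ row a := by
  refine ⟨fun ⟨_, h⟩ => (mem_row_of_mem_corners h).1, fun h => ?_⟩
  obtain ⟨c, hc⟩ := exists_mem_corners h
  exact ⟨⟨c, lt_of_mem_row a a.2 c (mem_row_of_mem_corners hc).2⟩, hc⟩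

/-- The cyclic family does not apply to `s = 1`, where its short families would need `-1` members
each. Here the vertices `18` and `17`, of degrees 3 and 14, are the letters. -/
theorem exists_splitComplete :
    ∃ (V : Type) (_ : Finite V) (G : SimpleGraph V),
      IsSplitComplete (12 * 1 + 6) G ∧ HasTriangularEmbedding G := by
  refine ⟨Fin 19, inferInstance, triangulation.graph,
    triangulation.splitComplete_of_adj 1 (u := 18) (v := 17) (by decide) (by simp) ?_ ?_ ?_ ?_ ?_⟩
  all_goals
    simp only [adj_triangulation]
    decide +kernel

end SmallTriangulation

theorem mainTheorem5 (s : ℕ) (hs : 1 ≤ s) :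
    ∃ (V : Type) (_ : Finite V) (G : SimpleGraph V),
      IsSplitComplete (12 * s + 6) G ∧ HasTriangularEmbedding G := by
  rcases hs.eq_or_lt with rfl | hs
  · exact SmallTriangulation.exists_splitComplete
  · exact CyclicTriangulation.exists_splitComplete hs
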